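/- **Setting.** Fix $n\ge 2$ processes $p_1,\dots,p_n$. For each $i$ let $\Sigma^<_i$ be a set of invocations and $\Sigma^>_i$ a set of responses of $p_i$ (all pairwise disjoint), and $\Sigma$ their union. An $\omega$-word $x$ over $\Sigma$ is well-formed if each local word $x|i$ (the projection to the symbols of $p_i$) is infinite and alternates invocations and responses, starting with an invocation; $\Sigma^\omega$ is the set of these words. An operation is an invocation in $x|i$ with the response that follows it in $x|i$. $op\prec_x op'$ means that the response of $op$ appears before the invocation of $op'$; $op$ and $op'$ are concurrent if neither $op\prec_x op'$ nor $op'\prec_x op$. A language is a subset of $\Sigma^\omega$. **Counter.** For the counter, $\Sigma^<_i=\{inc_i,read_i\}$ and $\Sigma^>_i=\{ack_i\}\cup\{val_i(m): m\in\mathbb N\}$. $SEC\_COUNT\subseteq\Sigma^\omega$ consists of the words $x$ in which every $inc$ is answered by $ack$, every $read$ is answered by (returns) a value, and 1. every $read$ returns at least the number of $inc$ operations of the same process that precede it; 2. every $read$ returns at least the value returned by the immediately previous $read$ of the same process; 3. some finite prefix $\alpha$ of $x$ is followed by a suffix having only $read$ operations, and for every such $\alpha$ eventually all operations return the number of $inc$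 operations in $\alpha$ (so words with infinitely many $inc$ operations are excluded); 4. every $read$ returns at most the number of $inc$ operations that precede it or are concurrent to it. **Algorithms and the timed adversary.** In an algorithm $V$ each $p_i$ is a state machine that repeats forever: (1) pick an arbitrary invocation $v_i\in\Sigma^<_i$; (2) run a block of atomic operations on a shared memory; (3) send $v_i$ to the timed adversary; (4) receive from it a pair $(w_i,view_i)$ with $w_i\in\Sigma^>_i$; (5) run a block of atomic operations on the shared memory and report YES or NO. Between (3) and (4) $p_i$ executes the code of the timed adversary, whose shared array $M[1..n]$ (initially all $\emptyset$) is not accessible to $V$: add $v_i$, made unique by tagging it with $i$ and the index of the operation among those of $p_i$, to the set $s_i$ of its announced invocations; write $s_i$ to $M[i]$; send $v_i$ to an inner adversary; receive from it an arbitrary $w_i\in\Sigma^>_i$; take an atomic snapshot of $M$ and let $view_i$ be the union of its entries; return $(w_i,view_i)$. An execution $E$ is an infinite interleaving of atomic steps of the processes from the initial configuration, with arbitrary schedule, picks and responses of the inner adversary. Blocks are wait-free: in every execution a process that takes infinitely many steps completes infinitely many iterations. $E$ is fair and failure-free if every process takes infinitely many steps. The input $x(E)$ is the sequence of invocations sent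 in (3) and responses received in (4), ignoring views, in the order in which these steps occur in $E$. $NO(E,p)\in\mathbb N\cup\{\infty\}$ is the number of times $p$ reports NO in $E$. $E\equiv E'$ means that every process passes through the same sequence of local states in $E$ and $E'$. The sketch $x^\sim(E)$ is built from the views of the operations of $E$: list the distinct views as $view_1\subset view_2\subset\cdots$ and, with $view_0=\emptyset$, for $k=1,2,\dots$ append first (untagged) the invocations in $view_k\setminus view_{k-1}$, in arbitrary order, and then the responses of the operations whose view is $view_k$, in arbitrary order. Statements about $x^\sim(E)$ below are meant for every choice of these orders. **Predictive weak decidability.** $L\subseteq\Sigma^\omega$ is predictively weakly decidable against the timed adversary if there is an algorithm $V$ such that for every fair failure-free execution $E$ of $V$: - if $x(E)\in L$, then either $NO(E,p)<\infty$ for all $p$, or else $NO(E,p)=\infty$ for some $p$, $x^\sim(E)\notin L$, and there is a fair failure-free execution $E'$ of $V$ with $E'\equiv E$ and $x(E')=x^\sim(E)$; - if $x(E)\notin L$, then $NO(E,p)=\infty$ for all $p$. **Lemma.** For every $n\ge 2$, $SEC\_COUNT$ is predictively weakly decidable against the timed adversary. -/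

import Mathlib

namespace DRV

/-! ## Distributed alphabets, words and languages -/

/-- A distributed alphabet for `n` processes: process `i` has an invocation alphabet `Inv i` and a
response alphabet `Resp i` (both possibly infinite). Disjointness is ensured by using the
disjoint union `DistAlphabet.Sym`. -/
structure DistAlphabet (n : ℕ) where
  Inv : Fin n → Type
  Resp : Fin n → Type

/-- The symbols of the alphabet: a process together with one of its invocations (`Sum.inl`) or one
of its responses (`Sum.inr`). -/
abbrev DistAlphabet.Sym {n : ℕ} (A : DistAlphabet n) : Type :=
  Σ i : Fin n, A.Inv i ⊕ A.Resp i

/-- An `ω`-word over the alphabet. -/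
abbrev DistAlphabet.Word {n : ℕ} (A : DistAlphabet n) : Type := ℕ → A.Sym

/-- The position in `x` of the `k`-th symbol (counting from `0`) of the local word `x|i`. -/
noncomputable def occ {n : ℕ} {A : DistAlphabet n} (x : A.Word) (i : Fin n) (k : ℕ) : ℕ :=
  Nat.nth (fun t => (x t).1 = i) k

/-- Well-formed `ω`-words. -/
structure WellFormed {n : ℕ} {A : DistAlphabet n} (x : A.Word) : Prop where
  /-- every local word is infinite -/
  reliable : ∀ i, {t | (x t).1 = i}.Infinite
  /-- every local word alternates invocations and responses, starting with an invocation -/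
  sequential : ∀ i k, (x (occ x i k)).2.isLeft = true ↔ Even k
  /-- the first `k` symbols of every local word appear in a finite prefix -/
  fair : ∀ i k, ∃ N, k ≤ ((Finset.range N).filter (fun t => (x t).1 = i)).card

/-- Names of operations: `(i, k)` is the `k`-th operation (counting from `0`) of process `i`. -/
abbrev Op (n : ℕ) : Type := Fin n × ℕ

/-- The position of the invocation of an operation. -/
noncomputable def invPos {n : ℕ} {A : DistAlphabet n} (x : A.Word) (p : Op n) : ℕ :=
  occ x p.1 (2 * p.2)

/-- The position of the response of an operation. -/
noncomputable def respPos {n : ℕ} {A : DistAlphabet n} (x : A.Word) (p : Op n) : ℕ :=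
  occ x p.1 (2 * p.2 + 1)

/-- `p ≺ₓ q`: the response of `p` appears before the invocation of `q`. -/
def Precedes {n : ℕ} {A : DistAlphabet n} (x : A.Word) (p q : Op n) : Prop :=
  respPos x p < invPos x q

/-- `p ||ₓ q`: neither operation precedes the other one. -/
def Concurrent {n : ℕ} {A : DistAlphabet n} (x : A.Word) (p q : Op n) : Prop :=
  ¬ Precedes x p q ∧ ¬ Precedes x q p

/-! ## The strongly-eventual consistent counter -/

/-- Invocations of the counter. -/
inductive CounterInv
  | inc
  | read

/-- Responses of the counter: the (empty) response to `inc()`, and the response to `read()`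
returning a value. -/
inductive CounterResp
  | ack
  | val (m : ℕ)

/-- The distributed alphabet of the counter. -/
abbrev counterAlphabet (n : ℕ) : DistAlphabet n where
  Inv := fun _ => CounterInv
  Resp := fun _ => CounterResp

/-- The operation `p` is an `inc`. -/
def IsInc {n : ℕ} (x : (counterAlphabet n).Word) (p : Op n) : Prop :=
  x (invPos x p) = ⟨p.1, Sum.inl CounterInv.inc⟩

/-- The operation `p` is a `read`. -/
def IsRead {n : ℕ} (x : (counterAlphabet n).Word) (p : Op n) : Prop :=
  x (invPos x p) = ⟨p.1, Sum.inl CounterInv.read⟩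

/-- The operation `p` is a `read` that returns `m`. -/
def Reads {n : ℕ} (x : (counterAlphabet n).Word) (p : Op n) (m : ℕ) : Prop :=
  IsRead x p ∧ x (respPos x p) = ⟨p.1, Sum.inr (CounterResp.val m)⟩

/-- In the suffix of `x` that starts at position `N` there are only symbols of `read` operations. -/
def OnlyReadsFrom {n : ℕ} (x : (counterAlphabet n).Word) (N : ℕ) : Prop :=
  ∀ p : Op n, N ≤ respPos x p → IsRead x p

/-- Weakly-eventual consistency of a well-formed word. -/
structure WeaklyEventual {n : ℕ} (x : (counterAlphabet n).Word) : Prop where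
  /-- responses match invocations: `inc` gets the empty response and `read` gets a value -/
  matching : ∀ p : Op n,
    (IsInc x p ∧ x (respPos x p) = ⟨p.1, Sum.inr CounterResp.ack⟩) ∨ ∃ m, Reads x p m
  /-- (1) a `read` returns at least the number of preceding `inc`s of the same process -/
  ownIncs : ∀ (p : Op n) (m : ℕ), Reads x p m →
    {q : Op n | q.1 = p.1 ∧ IsInc x q ∧ Precedes x q p}.encard ≤ (m : ℕ∞)
  /-- (2) a `read` returns at least the value of the previous `read` of the same process -/
  monotone : ∀ (i : Fin n) (k k' m m' : ℕ), k' < k → Reads x (i, k') m' → Reads x (i, k) m →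
    (∀ j, k' < j → j < k → ¬ IsRead x (i, j)) → m' ≤ m
  /-- (3), first half: some finite prefix is followed by `read` operations only -/
  finallyReads : ∃ N, OnlyReadsFrom x N
  /-- (3), second half: for every finite prefix followed by `read` operations only, eventually all
  operations return the number of `inc`s of that prefix -/
  converges : ∀ N, OnlyReadsFrom x N → ∃ c : ℕ,
    {q : Op n | IsInc x q ∧ respPos x q < N}.encard = (c : ℕ∞) ∧
      ∃ T, ∀ p : Op n, T ≤ respPos x p → Reads x p c

/-- Strongly-eventual consistency of a well-formed word. -/
structure StronglyEventual {n : ℕ} (x : (counterAlphabet n).Word) : Prop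
    extends WeaklyEventual x where
  /-- (4) a `read` returns at most the number of `inc`s that precede it or are concurrent to it -/
  bounded : ∀ (p : Op n) (m : ℕ), Reads x p m →
    (m : ℕ∞) ≤ {q : Op n | IsInc x q ∧ (Precedes x q p ∨ Concurrent x q p)}.encard

/-- The language of the strongly-eventual consistent counter for `n` processes. -/
def SEC_COUNT (n : ℕ) : Set (counterAlphabet n).Word :=
  {x | WellFormed x ∧ StronglyEventual x}

/-! ## Algorithms interacting with the timed adversary -/

/-- Invocations made unique: `⟨i, k, v⟩` is the invocation `v` of the `k`-th operation of
process `i`. -/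
abbrev TInv {n : ℕ} (A : DistAlphabet n) : Type := Σ i : Fin n, ℕ × A.Inv i

/-- Responses made unique: `⟨i, k, w⟩` is the response `w` of the `k`-th operation of
process `i`. -/
abbrev TResp {n : ℕ} (A : DistAlphabet n) : Type := Σ i : Fin n, ℕ × A.Resp i

/-- Report values. -/
inductive Verdict
  | yes
  | no

/-- A distributed algorithm. Every process `i` is a state machine with local states `Loc i` which
repeats forever: pick an invocation; run a block of atomic steps on the shared memory; send the
invocation to the adversary; receive a response and a view from it; run another block of atomic
steps; report a value. In a block, the local state determines whether the block is over (`none`)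
or which atomic operation on the shared memory is applied next (`some f`, where `f` gives the new
memory state and the new local state). -/
structure Algorithm {n : ℕ} (A : DistAlphabet n) where
  Mem : Type
  Loc : Fin n → Type
  memInit : Mem
  locInit : (i : Fin n) → Loc i
  pick : (i : Fin n) → Loc i → A.Inv i → Loc i
  pre : (i : Fin n) → Loc i → Option (Mem → Mem × Loc i)
  receive : (i : Fin n) → Loc i → A.Resp i → Set (TInv A) → Loc i
  post : (i : Fin n) → Loc i → Option (Mem → Mem × Loc i)
  report : (i : Fin n) → Loc i → Verdict
  next : (i : Fin n) → Loc i → Loc i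

/-- Where a process is in its loop, including the code of the timed adversary that it executes. -/
inductive Control {n : ℕ} (A : DistAlphabet n) (i : Fin n)
  /-- about to pick an invocation -/
  | atPick
  /-- in the block before sending `v`, or about to send `v` to the timed adversary -/
  | atPre (v : A.Inv i)
  /-- timed adversary: about to announce `v` in the shared array -/
  | atWrite (v : A.Inv i)
  /-- timed adversary: about to send `v` to the inner adversary -/
  | atForward (v : A.Inv i)
  /-- timed adversary: waiting for the response of the inner adversary -/
  | atWait (v : A.Inv i)
  /-- timed adversary: got `w` from the inner adversary, about to take the snapshot -/
  | atSnapshot (v : A.Inv i) (w : A.Resp i)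
  /-- timed adversary: about to send `(w, view)` back to the process -/
  | atReturn (v : A.Inv i) (w : A.Resp i) (view : Set (TInv A))
  /-- in the block after receiving, or about to report -/
  | atPost

/-- The local state of a process: its state in the algorithm, its control location, the number of
operations it has completed, and its persistent variable in the timed adversary (the set of
invocations it has announced so far). -/
structure ProcState {n : ℕ} {A : DistAlphabet n} (V : Algorithm A) (i : Fin n) where
  loc : V.Loc i
  ctrl : Control A i
  ops : ℕ
  announced : Set (TInv A)

/-- A configuration: the local states, the shared memory of the algorithm, and the shared array of
the timed adversary. -/
structure Config {n : ℕ} {A : DistAlphabet n} (V : Algorithm A) where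
  proc : (i : Fin n) → ProcState V i
  mem : V.Mem
  arr : Fin n → Set (TInv A)

/-- The initial configuration. -/
def Config.initial {n : ℕ} {A : DistAlphabet n} (V : Algorithm A) : Config V where
  proc := fun i => { loc := V.locInit i, ctrl := Control.atPick, ops := 0, announced := ∅ }
  mem := V.memInit
  arr := fun _ => ∅

/-- What a step of process `i` shows: sending an invocation to the timed adversary, receiving a
response from it (ignoring the view), reporting a value, or nothing of these. -/
inductive Label {n : ℕ} (A : DistAlphabet n) (i : Fin n)
  | internal
  | send (v : A.Inv i)
  | receive (w : A.Resp i)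
  | report (d : Verdict)

/-- The input symbol shown by a step, if any. -/
def Label.sym {n : ℕ} {A : DistAlphabet n} {i : Fin n} : Label A i → Option A.Sym
  | .internal => none
  | .send v => some ⟨i, Sum.inl v⟩
  | .receive w => some ⟨i, Sum.inr w⟩
  | .report _ => none

/-- The steps of process `i`: `LocalStep V i s m a ℓ s' m' a'` says that in local state `s`, with
shared memory `m` and shared array `a` of the timed adversary, process `i` can perform a step
showing `ℓ` that leads to `s'`, `m'` and `a'`. The only nondeterminism is the choice of the
invocation (`pick`) and of the response of the inner adversary (`answer`). -/
inductive LocalStep {n : ℕ} {A : DistAlphabet n} (V : Algorithm A) (i : Fin n) :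
    ProcState V i → V.Mem → (Fin n → Set (TInv A)) → Label A i →
    ProcState V i → V.Mem → (Fin n → Set (TInv A)) → Prop
  | pick (l : V.Loc i) (k : ℕ) (s : Set (TInv A)) (m : V.Mem) (a : Fin n → Set (TInv A))
      (v : A.Inv i) :
      LocalStep V i ⟨l, .atPick, k, s⟩ m a .internal ⟨V.pick i l v, .atPre v, k, s⟩ m a
  | pre (l : V.Loc i) (k : ℕ) (s : Set (TInv A)) (m : V.Mem) (a : Fin n → Set (TInv A))
      (v : A.Inv i) (f : V.Mem → V.Mem × V.Loc i) (h : V.pre i l = some f) :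
      LocalStep V i ⟨l, .atPre v, k, s⟩ m a .internal ⟨(f m).2, .atPre v, k, s⟩ (f m).1 a
  | send (l : V.Loc i) (k : ℕ) (s : Set (TInv A)) (m : V.Mem) (a : Fin n → Set (TInv A))
      (v : A.Inv i) (h : V.pre i l = none) :
      LocalStep V i ⟨l, .atPre v, k, s⟩ m a (.send v) ⟨l, .atWrite v, k, s⟩ m a
  | write (l : V.Loc i) (k : ℕ) (s : Set (TInv A)) (m : V.Mem) (a : Fin n → Set (TInv A))
      (v : A.Inv i) :
      LocalStep V i ⟨l, .atWrite v, k, s⟩ m a .internal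
        ⟨l, .atForward v, k, s ∪ {⟨i, k, v⟩}⟩ m (Function.update a i (s ∪ {⟨i, k, v⟩}))
  | forward (l : V.Loc i) (k : ℕ) (s : Set (TInv A)) (m : V.Mem) (a : Fin n → Set (TInv A))
      (v : A.Inv i) :
      LocalStep V i ⟨l, .atForward v, k, s⟩ m a .internal ⟨l, .atWait v, k, s⟩ m a
  | answer (l : V.Loc i) (k : ℕ) (s : Set (TInv A)) (m : V.Mem) (a : Fin n → Set (TInv A))
      (v : A.Inv i) (w : A.Resp i) :
      LocalStep V i ⟨l, .atWait v, k, s⟩ m a .internal ⟨l, .atSnapshot v w, k, s⟩ m a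
  | snapshot (l : V.Loc i) (k : ℕ) (s : Set (TInv A)) (m : V.Mem) (a : Fin n → Set (TInv A))
      (v : A.Inv i) (w : A.Resp i) :
      LocalStep V i ⟨l, .atSnapshot v w, k, s⟩ m a .internal
        ⟨l, .atReturn v w (⋃ j, a j), k, s⟩ m a
  | receive (l : V.Loc i) (k : ℕ) (s : Set (TInv A)) (m : V.Mem) (a : Fin n → Set (TInv A))
      (v : A.Inv i) (w : A.Resp i) (view : Set (TInv A)) :
      LocalStep V i ⟨l, .atReturn v w view, k, s⟩ m a (.receive w)
        ⟨V.receive i l w view, .atPost, k + 1, s⟩ m a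
  | post (l : V.Loc i) (k : ℕ) (s : Set (TInv A)) (m : V.Mem) (a : Fin n → Set (TInv A))
      (f : V.Mem → V.Mem × V.Loc i) (h : V.post i l = some f) :
      LocalStep V i ⟨l, .atPost, k, s⟩ m a .internal ⟨(f m).2, .atPost, k, s⟩ (f m).1 a
  | report (l : V.Loc i) (k : ℕ) (s : Set (TInv A)) (m : V.Mem) (a : Fin n → Set (TInv A))
      (h : V.post i l = none) :
      LocalStep V i ⟨l, .atPost, k, s⟩ m a (.report (V.report i l))
        ⟨V.next i l, .atPick, k, s⟩ m a

/-- An execution: an infinite sequence of configurations and steps that starts in the initial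
configuration. The schedule (`actor`) is arbitrary; processes may crash. -/
structure Execution {n : ℕ} {A : DistAlphabet n} (V : Algorithm A) where
  cfg : ℕ → Config V
  actor : ℕ → Fin n
  label : (t : ℕ) → Label A (actor t)
  start : cfg 0 = Config.initial V
  step : ∀ t, LocalStep V (actor t)
    ((cfg t).proc (actor t)) (cfg t).mem (cfg t).arr (label t)
    ((cfg (t + 1)).proc (actor t)) (cfg (t + 1)).mem (cfg (t + 1)).arr
  idle : ∀ t j, j ≠ actor t → (cfg (t + 1)).proc j = (cfg t).proc j

namespace Execution

/-- Failure-free and fair: every process takes infinitely many steps. -/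
def Fair {n : ℕ} {A : DistAlphabet n} {V : Algorithm A} (E : Execution V) : Prop :=
  ∀ i, {t | E.actor t = i}.Infinite

/-- The times at which process `i` reports `d`. -/
def reportTimes {n : ℕ} {A : DistAlphabet n} {V : Algorithm A} (E : Execution V)
    (i : Fin n) (d : Verdict) : Set ℕ :=
  {t | E.actor t = i ∧ E.label t = Label.report d}

/-- `NO(E, i)`: the number, possibly infinite, of times that process `i` reports `NO`. -/
noncomputable def no {n : ℕ} {A : DistAlphabet n} {V : Algorithm A} (E : Execution V)
    (i : Fin n) : ℕ∞ :=
  (E.reportTimes i Verdict.no).encard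

/-- `x = x(E)`: the `ω`-word `x` is the input in `E`, the subsequence of the invocations sent to
and the responses received from the timed adversary. -/
def IsInput {n : ℕ} {A : DistAlphabet n} {V : Algorithm A} (E : Execution V)
    (x : A.Word) : Prop :=
  ∃ f : ℕ → ℕ, StrictMono f ∧ Set.range f = {t | (E.label t).sym ≠ none} ∧
    ∀ k, (E.label (f k)).sym = some (x k)

/-- The local state of process `i` after its `k`-th step (counting from `0`). -/
noncomputable def localState {n : ℕ} {A : DistAlphabet n} {V : Algorithm A} (E : Execution V)
    (i : Fin n) (k : ℕ) : ProcState V i :=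
  (E.cfg (Nat.nth (fun t => E.actor t = i) k + 1)).proc i

/-- `E ≡ E'` (used for fair executions): every process passes through the same sequence of local
states. (The initial local states are always the same.) -/
def Indist {n : ℕ} {A : DistAlphabet n} {V : Algorithm A} (E E' : Execution V) : Prop :=
  ∀ i k, E.localState i k = E'.localState i k

/-- In `E`, the `k`-th operation of process `i` has invocation `v`, response `w` and view `view`:
at some time the process receives `(w, view)` from the timed adversary in that operation. -/
def HasOp {n : ℕ} {A : DistAlphabet n} {V : Algorithm A} (E : Execution V) (i : Fin n) (k : ℕ)
    (v : A.Inv i) (w : A.Resp i) (view : Set (TInv A)) : Prop :=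
  ∃ t, E.actor t = i ∧ ((E.cfg t).proc i).ops = k ∧
    ((E.cfg t).proc i).ctrl = Control.atReturn v w view

end Execution

/-- The first `k` rounds of the construction of the sketch: in round `j` the invocations in the list
`I j` and then the responses in the list `R j` are appended. -/
def sketchPrefix {n : ℕ} {A : DistAlphabet n} (I : ℕ → List (TInv A)) (R : ℕ → List (TResp A)) :
    ℕ → List A.Sym
  | 0 => []
  | k + 1 => sketchPrefix I R k ++ (I k).map (fun a => ⟨a.1, Sum.inl a.2.2⟩)
      ++ (R k).map (fun b => ⟨b.1, Sum.inr b.2.2⟩)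

/-- `y` is one of the histories denoted `x^∼(E)`: the distinct views in `E` are enumerated in
ascending containment order; for each of them, in this order, the invocations that are in this
view and in no earlier one are appended in an arbitrary order, and then the responses of the
operations that have this view are appended in an arbitrary order. -/
def Execution.IsSketch {n : ℕ} {A : DistAlphabet n} {V : Algorithm A} (E : Execution V)
    (y : A.Word) : Prop :=
  ∃ (views : ℕ → Set (TInv A)) (I : ℕ → List (TInv A)) (R : ℕ → List (TResp A)),
    StrictMono views ∧
    Set.range views = {u | ∃ i k v w, E.HasOp i k v w u} ∧
    (∀ k, (I k).Nodup ∧ ∀ a, a ∈ I k ↔ a ∈ views k ∧ ∀ j < k, a ∉ views j) ∧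
    (∀ k, (R k).Nodup ∧ ∀ b, b ∈ R k ↔ ∃ v, E.HasOp b.1 b.2.1 v b.2.2 (views k)) ∧
    ∀ k t (ht : t < (sketchPrefix I R k).length), y t = (sketchPrefix I R k)[t]

/-! ## Predictive weak decidability -/

/-- The blocks of code of the algorithm are wait-free: in every execution, whatever the schedule
(including crashes of other processes), a process that takes infinitely many steps completes
infinitely many iterations of its loop, that is, it is never stuck in a block. -/
def Algorithm.WaitFree {n : ℕ} {A : DistAlphabet n} (V : Algorithm A) : Prop :=
  ∀ (E : Execution V) (i : Fin n), {t | E.actor t = i}.Infinite →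
    {t | E.actor t = i ∧ ∃ d, t ∈ E.reportTimes i d}.Infinite

/-- `V` predictively weakly decides `L` against the timed adversary. The sketch `x^∼(E)` is
determined up to the arbitrary orders in its construction; the requirements on it are made for
every choice of these orders. -/
def Algorithm.PredictivelyWeaklyDecides {n : ℕ} {A : DistAlphabet n} (V : Algorithm A)
    (L : Set A.Word) : Prop :=
  ∀ E : Execution V, E.Fair → ∃ x : A.Word, E.IsInput x ∧
    (x ∈ L →
      (∀ p, E.no p < ⊤) ∨
      ((∃ p, E.no p = ⊤) ∧
        (∃ y, E.IsSketch y) ∧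
        ∀ y, E.IsSketch y → y ∉ L ∧
          ∃ E' : Execution V, E'.Fair ∧ E'.Indist E ∧ E'.IsInput y)) ∧
    (x ∉ L → ∀ p, E.no p = ⊤)

/-- The class of predictively weakly decidable languages. -/
def PWD {n : ℕ} (A : DistAlphabet n) : Set (Set A.Word) :=
  {L | (∀ x ∈ L, WellFormed x) ∧
    ∃ V : Algorithm A, V.WaitFree ∧ V.PredictivelyWeaklyDecides L}

end DRV

/-!
The monitor that decides the counter works as follows. Each process keeps the history of its own
operations and of their views. After an operation it raises an objection, by incrementing a shared
number, if its history violates a requirement that concerns this process only, if one of its `read`s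
returned more than the number of `inc`s in the view of that `read`, or if the operation is an `inc`
or a `read` whose value differs from the number of `inc`s in its view. It reports `NO` whenever the
shared number has changed since its previous operation. Hence every process reports `NO` infinitely
often if there are infinitely many objections, and no process does otherwise
(`Execution.no_eq_top_iff`).

If there are finitely many `inc`s, then all but finitely many views contain all of them. So there
are finitely many objections if and only if the operations satisfy all requirements on the counter,
with requirement (4) replaced by: a `read` returns at most the number of `inc`s in its view
(`Execution.Ops.finite_suspects_iff`). A word belongs to the language if and only if its operations
satisfy the requirements (1) to (3), which do not depend on the interleaving of the processes, and
each `read` returns at most the number of `inc`s whose invocations occur before its response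
(`Layout.mem_SEC_COUNT_iff`). In the input, every invocation in the view of an operation occurs
before its response, because it is sent before it is written and the snapshot is taken before the
response is received (`Execution.Ops.exists_input`). So an input outside the language leads to
infinitely many objections. In a sketch, the invocations before the response of an operation are
exactly those in its view (`Execution.Ops.layout_of_isSketch`), so infinitely many objections mean
that no sketch belongs to the language.

It remains to see that a sketch `y` is the input of an indistinguishable execution
(`Execution.exists_indist_of_isSketch`), which holds for fair executions of every wait-free
algorithm. The views are not changed by delaying the sending and the write of an invocation, or by
advancing a snapshot and the reception of its response, as long as no write passes a snapshot. All
steps of the timed adversary for position `m` of `y` are moved to the time of the first snapshot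
whose response is at position `m` of `y` or later. This time is after the writes of the invocations
at positions up to `m` and not after the snapshots of the responses from `m` on, so the steps of
each process keep their order (`Execution.sortKey_lt_of_actor_eq`). Sorting the steps in this way
gives an execution (`Execution.exists_permuted`).

The stage of a process is measured by `ProcState.clock`, which advances by one with every step that
is not an operation on the memory of the algorithm. The steps of an operation are thus the times at
which this clock passes given values.
-/

namespace DRV

variable {n : ℕ} {A : DistAlphabet n} {V : Algorithm A}

/-! ### The clock of a process -/

/-- The phase of a process within an iteration of its loop, numbered so that an iteration, counted
from its reception of a response, goes through the phases `0, …, 7` in this order. -/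
def Control.phase {i : Fin n} : Control A i → ℕ
  | .atPost => 0
  | .atPick => 1
  | .atPre _ => 2
  | .atWrite _ => 3
  | .atForward _ => 4
  | .atWait _ => 5
  | .atSnapshot _ _ => 6
  | .atReturn _ _ _ => 7

/-- The progress of a process through its loop. A step on the memory of the algorithm leaves the
clock unchanged, and every other step advances it by one. -/
def ProcState.clock {i : Fin n} (s : ProcState V i) : ℕ :=
  8 * s.ops + s.ctrl.phase

lemma Control.phase_lt {i : Fin n} (c : Control A i) : c.phase < 8 := by
  cases c <;> simp [Control.phase]

lemma ProcState.ops_eq {i : Fin n} (s : ProcState V i) : s.ops = s.clock / 8 := by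
  have := s.ctrl.phase_lt
  unfold ProcState.clock
  omega

lemma ProcState.phase_eq {i : Fin n} (s : ProcState V i) : s.ctrl.phase = s.clock % 8 := by
  have := s.ctrl.phase_lt
  unfold ProcState.clock
  omega

lemma LocalStep.clock_cases {i : Fin n} {s s' : ProcState V i} {m m' : V.Mem}
    {a a' : Fin n → Set (TInv A)} {l : Label A i} (h : LocalStep V i s m a l s' m' a') :
    (s'.clock = s.clock ∧ (s.ctrl.phase = 0 ∨ s.ctrl.phase = 2)) ∨
      (s'.clock = s.clock + 1 ∧ m' = m) := by
  cases h <;> simp [ProcState.clock, Control.phase]; ring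

lemma LocalStep.announced_eq {i : Fin n} {s s' : ProcState V i} {m m' : V.Mem}
    {a a' : Fin n → Set (TInv A)} {l : Label A i} (h : LocalStep V i s m a l s' m' a')
    (ha : a i = s.announced) : a' = Function.update a i s'.announced := by
  cases h <;> simp_all

lemma LocalStep.sym_of_receive {i : Fin n} {s s' : ProcState V i} {m m' : V.Mem}
    {a a' : Fin n → Set (TInv A)} {l : Label A i} (h : LocalStep V i s m a l s' m' a')
    {v : A.Inv i} {w : A.Resp i} {u : Set (TInv A)} (hc : s.ctrl = .atReturn v w u) :
    l.sym = some ⟨i, Sum.inr w⟩ := by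
  cases h <;> simp at hc
  simp [Label.sym, hc]

lemma LocalStep.clock_of_visible {i : Fin n} {s s' : ProcState V i} {m m' : V.Mem}
    {a a' : Fin n → Set (TInv A)} {l : Label A i} (h : LocalStep V i s m a l s' m' a')
    (hl : l.sym ≠ none) :
    s'.clock = s.clock + 1 ∧ (s.ctrl.phase = 2 ∨ s.ctrl.phase = 7) := by
  cases h <;> simp_all [Label.sym, ProcState.clock, Control.phase]
  omega

lemma LocalStep.announced_of_write {i : Fin n} {s s' : ProcState V i} {m m' : V.Mem}
    {a a' : Fin n → Set (TInv A)} {l : Label A i} (h : LocalStep V i s m a l s' m' a')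
    {v : A.Inv i} (hc : s.ctrl = .atWrite v) :
    s'.announced = s.announced ∪ {⟨i, s.ops, v⟩} := by
  cases h <;> simp at hc
  simp [hc]

lemma LocalStep.announced_of_ne {i : Fin n} {s s' : ProcState V i} {m m' : V.Mem}
    {a a' : Fin n → Set (TInv A)} {l : Label A i} (h : LocalStep V i s m a l s' m' a')
    (hc : s.ctrl.phase ≠ 3) : s'.announced = s.announced := by
  cases h <;> simp_all [Control.phase]

lemma LocalStep.clock_eq {i : Fin n} {s s' : ProcState V i} {m m' : V.Mem}
    {a a' : Fin n → Set (TInv A)} {l : Label A i} (h : LocalStep V i s m a l s' m' a')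
    (h0 : s.ctrl.phase ≠ 0) (h2 : s.ctrl.phase ≠ 2) : s'.clock = s.clock + 1 := by
  rcases h.clock_cases with h | h
  · tauto
  · exact h.1

lemma LocalStep.chain {i : Fin n} {s2 s3 s4 s5 s6 s7 : ProcState V i}
    {m2 m3 m4 m5 m6 m2' m3' m4' m5' m6' : V.Mem}
    {a2 a3 a4 a5 a6 a2' a3' a4' a5' a6' : Fin n → Set (TInv A)} {l2 l3 l4 l5 l6 : Label A i}
    (h2 : LocalStep V i s2 m2 a2 l2 s3 m2' a2') (h3 : LocalStep V i s3 m3 a3 l3 s4 m3' a3')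
    (h4 : LocalStep V i s4 m4 a4 l4 s5 m4' a4') (h5 : LocalStep V i s5 m5 a5 l5 s6 m5' a5')
    (h6 : LocalStep V i s6 m6 a6 l6 s7 m6' a6') (hs2 : s2.ctrl.phase = 2)
    (hs3 : s3.ctrl.phase = 3) {v : A.Inv i} {w : A.Resp i} {u : Set (TInv A)}
    (hs7 : s7.ctrl = .atReturn v w u) :
    l2 = .send v ∧ s3.ctrl = .atWrite v ∧ u = ⋃ j, a6 j := by
  cases h2 <;> simp [Control.phase] at hs2 hs3
  cases h3
  cases h4
  cases h5
  cases h6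
  simp at hs7
  simp [hs7]

namespace Execution

variable (E : Execution V)

/-- The clock of process `i` before the step at time `t`. -/
def clock (i : Fin n) (t : ℕ) : ℕ := ((E.cfg t).proc i).clock

/-- Every process passes through every stage of its loop. -/
def Live : Prop := ∀ i m, ∃ t, m < E.clock i t

/-- The time of the step that advances the clock of process `i` from `m` to `m + 1`. -/
noncomputable def time (i : Fin n) (m : ℕ) : ℕ := sInf {t | m < E.clock i (t + 1)}

variable {E}

lemma step_of_actor {t : ℕ} {i : Fin n} (h : E.actor t = i) :
    ∃ l : Label A i, l.sym = (E.label t).sym ∧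
      (∀ d, l = Label.report d ↔ E.label t = Label.report d) ∧
      LocalStep V i ((E.cfg t).proc i) (E.cfg t).mem (E.cfg t).arr l
        ((E.cfg (t + 1)).proc i) (E.cfg (t + 1)).mem (E.cfg (t + 1)).arr := by
  subst h
  exact ⟨_, rfl, fun _ => Iff.rfl, E.step t⟩

lemma proc_eq_of_idle {i : Fin n} {t t' : ℕ} (htt : t ≤ t')
    (h : ∀ u, t ≤ u → u < t' → E.actor u ≠ i) : (E.cfg t').proc i = (E.cfg t).proc i := by
  induction t', htt using Nat.le_induction with
  | base => rfl
  | succ u hu ih =>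
    rw [E.idle u i (h u hu (by omega)).symm, ih fun v hv hv' => h v hv (by omega)]

lemma clock_zero (i : Fin n) : E.clock i 0 = 1 := by
  simp [clock, E.start, Config.initial, ProcState.clock, Control.phase]

lemma clock_succ (i : Fin n) (t : ℕ) :
    E.clock i (t + 1) = E.clock i t ∨ (E.clock i (t + 1) = E.clock i t + 1 ∧ E.actor t = i) := by
  by_cases h : E.actor t = i
  · obtain ⟨l, -, -, hl⟩ := step_of_actor h
    rcases hl.clock_cases with h1 | h1
    · exact Or.inl h1.1
    · exact Or.inr ⟨h1.1, h⟩
  · left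
    unfold clock
    rw [E.idle t i (Ne.symm h)]

lemma clock_mono (i : Fin n) : Monotone (E.clock i) :=
  monotone_nat_of_le_succ fun t => by rcases E.clock_succ i t with h | h <;> omega

lemma one_le_clock (i : Fin n) (t : ℕ) : 1 ≤ E.clock i t := by
  have := E.clock_mono i (Nat.zero_le t)
  rwa [clock_zero] at this

lemma lt_clock_iff (hE : E.Live) {i : Fin n} {m t : ℕ} (hm : 1 ≤ m) :
    m < E.clock i t ↔ E.time i m < t := by
  constructor
  · intro h
    obtain _ | t := t
    · rw [clock_zero] at h; omega
    · exact Nat.lt_succ_of_le (Nat.sInf_le h)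
  · intro h
    have hne : {t | m < E.clock i (t + 1)}.Nonempty := by
      obtain ⟨t, ht⟩ := hE i m
      exact ⟨t, ht.trans_le (E.clock_mono i (Nat.le_succ t))⟩
    have hmem : m < E.clock i (E.time i m + 1) := Nat.sInf_mem hne
    exact hmem.trans_le (E.clock_mono i h)

lemma clock_time (hE : E.Live) {i : Fin n} {m : ℕ} (hm : 1 ≤ m) :
    E.clock i (E.time i m) = m ∧ E.clock i (E.time i m + 1) = m + 1 ∧
      E.actor (E.time i m) = i := by
  have h1 := (lt_clock_iff hE (i := i) (t := E.time i m) hm).not.2 (lt_irrefl _)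
  have h2 := (lt_clock_iff hE (i := i) (t := E.time i m + 1) hm).2 (Nat.lt_succ_self _)
  rcases E.clock_succ i (E.time i m) with h | ⟨h, h'⟩
  · omega
  · exact ⟨by omega, by omega, h'⟩

lemma eq_time (hE : E.Live) {i : Fin n} {t : ℕ} (h : E.clock i (t + 1) = E.clock i t + 1) :
    t = E.time i (E.clock i t) := by
  have h1 := (lt_clock_iff hE (E.one_le_clock i t) (t := t)).not.1 (lt_irrefl _)
  have h2 := (lt_clock_iff hE (E.one_le_clock i t) (t := t + 1)).1
    (by rw [h]; exact Nat.lt_succ_self _)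
  omega

lemma time_lt_time (hE : E.Live) {i : Fin n} {l m : ℕ} (hl : 1 ≤ l) (h : l < m) :
    E.time i l < E.time i m := by
  rw [← lt_clock_iff hE hl, (clock_time hE (by omega)).1]
  exact h

lemma time_inj (hE : E.Live) {i j : Fin n} {l m : ℕ} (hl : 1 ≤ l) (hm : 1 ≤ m)
    (h : E.time i l = E.time j m) : i = j ∧ l = m := by
  have hij : i = j := by
    rw [← (clock_time hE (i := i) hl).2.2, h, (clock_time hE hm).2.2]
  subst hij
  refine ⟨rfl, ?_⟩
  rw [← (clock_time hE (i := i) hl).1, h, (clock_time hE hm).1]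

/-- Outside the blocks of the algorithm the steps of a process follow each other directly: the
state after one step is the state before the next one. -/
lemma proc_time_succ (hE : E.Live) {i : Fin n} {m : ℕ} (hm : 1 ≤ m) (h0 : (m + 1) % 8 ≠ 0)
    (h2 : (m + 1) % 8 ≠ 2) :
    (E.cfg (E.time i (m + 1))).proc i = (E.cfg (E.time i m + 1)).proc i := by
  refine proc_eq_of_idle (time_lt_time hE hm (Nat.lt_succ_self m)) fun u hu hu' hact => ?_
  have hc : E.clock i u = m + 1 := by
    have h1 := (lt_clock_iff hE hm (i := i)).2 hu
    have h2 := (lt_clock_iff hE (Nat.le_add_left 1 m) (i := i) (t := u)).not.2 (by omega)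
    omega
  obtain ⟨l, -, -, hl⟩ := step_of_actor hact
  rcases hl.clock_cases with h | h
  · rw [ProcState.phase_eq] at h
    change _ ∧ (E.clock i u % 8 = 0 ∨ E.clock i u % 8 = 2) at h
    omega
  · have h1 : E.clock i (u + 1) = E.clock i u + 1 := h.1
    have := eq_time hE h1
    rw [hc] at this
    omega

lemma step_time (hE : E.Live) (i : Fin n) {m : ℕ} (hm : 1 ≤ m) :
    ∃ l : Label A i, l.sym = (E.label (E.time i m)).sym ∧
      LocalStep V i ((E.cfg (E.time i m)).proc i) (E.cfg (E.time i m)).mem (E.cfg (E.time i m)).arr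
        l ((E.cfg (E.time i m + 1)).proc i) (E.cfg (E.time i m + 1)).mem
        (E.cfg (E.time i m + 1)).arr := by
  obtain ⟨l, h1, -, h2⟩ := step_of_actor (clock_time hE (i := i) hm).2.2
  exact ⟨l, h1, h2⟩

lemma ctrl_phase_time (hE : E.Live) (i : Fin n) {m : ℕ} (hm : 1 ≤ m) :
    ((E.cfg (E.time i m)).proc i).ctrl.phase = m % 8 := by
  rw [ProcState.phase_eq]
  exact congrArg (· % 8) (clock_time hE hm).1

lemma ops_time (hE : E.Live) (i : Fin n) {m : ℕ} (hm : 1 ≤ m) :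
    ((E.cfg (E.time i m)).proc i).ops = m / 8 := by
  rw [ProcState.ops_eq]
  exact congrArg (· / 8) (clock_time hE hm).1

lemma arr_eq_announced (t : ℕ) (j : Fin n) :
    (E.cfg t).arr j = ((E.cfg t).proc j).announced := by
  induction t generalizing j with
  | zero => simp [E.start, Config.initial]
  | succ t ih =>
    obtain ⟨l, -, -, hl⟩ := step_of_actor (E := E) (t := t) rfl
    rw [hl.announced_eq (ih _)]
    by_cases hj : j = E.actor t
    · subst hj; simp
    · rw [Function.update_of_ne hj, ih, E.idle t j hj]

/-! ### The operations of an execution -/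

/-- The time at which the invocation of the operation `p` is sent. -/
noncomputable def sendTime (E : Execution V) (p : Op n) : ℕ := E.time p.1 (8 * p.2 + 2)

/-- The time at which the invocation of the operation `p` is written to the shared array. -/
noncomputable def writeTime (E : Execution V) (p : Op n) : ℕ := E.time p.1 (8 * p.2 + 3)

/-- The time of the snapshot of the operation `p`. -/
noncomputable def snapTime (E : Execution V) (p : Op n) : ℕ := E.time p.1 (8 * p.2 + 6)

/-- The time at which the response of the operation `p` is received. -/
noncomputable def recvTime (E : Execution V) (p : Op n) : ℕ := E.time p.1 (8 * p.2 + 7)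

/-- The invocations, responses and views of the operations of an execution. -/
structure Ops (E : Execution V) where
  inv : ∀ p : Op n, A.Inv p.1
  resp : ∀ p : Op n, A.Resp p.1
  view : Op n → Set (TInv A)
  hasOp : ∀ p : Op n, E.HasOp p.1 p.2 (inv p) (resp p) (view p)

lemma exists_hasOp (hE : E.Live) (i : Fin n) (k : ℕ) : ∃ v w u, E.HasOp i k v w u := by
  have h := ctrl_phase_time hE i (m := 8 * k + 7) (by omega)
  have hk := ops_time hE i (m := 8 * k + 7) (by omega)
  generalize hc : ((E.cfg (E.time i (8 * k + 7))).proc i).ctrl = c at h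
  cases c <;> simp only [Control.phase] at h <;> first | omega | skip
  exact ⟨_, _, _, E.time i (8 * k + 7), (clock_time hE (by omega)).2.2, by omega, hc⟩

lemma Live.nonempty_ops (hE : E.Live) : Nonempty E.Ops := by
  choose v w u h using fun p : Op n => exists_hasOp hE p.1 p.2
  exact ⟨⟨v, w, u, h⟩⟩

lemma eq_recvTime (hE : E.Live) {i : Fin n} {k t : ℕ} {v : A.Inv i} {w : A.Resp i}
    {u : Set (TInv A)} (hact : E.actor t = i) (hk : ((E.cfg t).proc i).ops = k)
    (hc : ((E.cfg t).proc i).ctrl = .atReturn v w u) : t = E.recvTime (i, k) := by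
  have hcl : E.clock i t = 8 * k + 7 := by
    simp [clock, ProcState.clock, hk, hc, Control.phase]
  obtain ⟨l, -, -, hl⟩ := step_of_actor hact
  rcases hl.clock_cases with h | h
  · simp [hc, Control.phase] at h
  · have := eq_time hE (i := i) h.1
    rwa [hcl] at this

lemma HasOp.ctrl_recvTime (hE : E.Live) {i : Fin n} {k : ℕ} {v : A.Inv i} {w : A.Resp i}
    {u : Set (TInv A)} (h : E.HasOp i k v w u) :
    ((E.cfg (E.recvTime (i, k))).proc i).ctrl = .atReturn v w u := by
  obtain ⟨t, hact, hk, hc⟩ := h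
  rwa [← eq_recvTime hE hact hk hc]

namespace Ops

variable (O : E.Ops)

lemma eq_of_hasOp (hE : E.Live) {i : Fin n} {k : ℕ} {v : A.Inv i} {w : A.Resp i}
    {u : Set (TInv A)} (h : E.HasOp i k v w u) :
    v = O.inv (i, k) ∧ w = O.resp (i, k) ∧ u = O.view (i, k) := by
  have := (h.ctrl_recvTime hE).symm.trans ((O.hasOp (i, k)).ctrl_recvTime hE)
  simpa using this

/-- The invocation of the operation `p`, made unique. -/
def tag (p : Op n) : TInv A := ⟨p.1, p.2, O.inv p⟩

lemma tag_injective : Function.Injective O.tag := by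
  rintro ⟨i, k⟩ ⟨j, l⟩ h
  simp only [tag, Sigma.mk.injEq] at h
  obtain ⟨rfl, h⟩ := h
  simpa using congrArg Prod.fst (eq_of_heq h)

/-- What happens in the operation `p`, read off from its consecutive steps. -/
lemma steps (hE : E.Live) (p : Op n) :
    (E.label (E.sendTime p)).sym = some ⟨p.1, Sum.inl (O.inv p)⟩ ∧
      ((E.cfg (E.writeTime p)).proc p.1).ctrl = .atWrite (O.inv p) ∧
      O.view p = ⋃ j, (E.cfg (E.snapTime p)).arr j := by
  obtain ⟨l2, hl2, h2⟩ := step_time hE p.1 (m := 8 * p.2 + 2) (by omega)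
  obtain ⟨l3, -, h3⟩ := step_time hE p.1 (m := 8 * p.2 + 3) (by omega)
  obtain ⟨l4, -, h4⟩ := step_time hE p.1 (m := 8 * p.2 + 4) (by omega)
  obtain ⟨l5, -, h5⟩ := step_time hE p.1 (m := 8 * p.2 + 5) (by omega)
  obtain ⟨l6, -, h6⟩ := step_time hE p.1 (m := 8 * p.2 + 6) (by omega)
  rw [← proc_time_succ hE (by omega) (by omega) (by omega)] at h2 h3 h4 h5 h6
  obtain ⟨h, h', h''⟩ := h2.chain h3 h4 h5 h6 ((ctrl_phase_time hE _ (by omega)).trans (by omega))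
    ((ctrl_phase_time hE _ (by omega)).trans (by omega)) ((O.hasOp p).ctrl_recvTime hE)
  refine ⟨?_, h', h''⟩
  rw [sendTime, ← hl2, h]
  rfl

lemma recv_sym (hE : E.Live) (p : Op n) :
    (E.label (E.recvTime p)).sym = some ⟨p.1, Sum.inr (O.resp p)⟩ := by
  obtain ⟨l, hl, h⟩ := step_time hE p.1 (m := 8 * p.2 + 7) (by omega)
  have hc := (O.hasOp p).ctrl_recvTime hE
  change ((E.cfg (E.time p.1 (8 * p.2 + 7))).proc p.1).ctrl = _ at hc
  rw [recvTime, ← hl, h.sym_of_receive hc]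

/-- Only the sending of an invocation and the reception of a response are visible. -/
lemma exists_of_sym_ne_none (hE : E.Live) {t : ℕ} (h : (E.label t).sym ≠ none) :
    ∃ p, t = E.sendTime p ∨ t = E.recvTime p := by
  obtain ⟨l, hl, -, hs⟩ := step_of_actor (E := E) (t := t) rfl
  rw [← hl] at h
  have hcl : E.clock (E.actor t) (t + 1) = E.clock (E.actor t) t + 1 ∧
      (E.clock (E.actor t) t % 8 = 2 ∨ E.clock (E.actor t) t % 8 = 7) := by
    unfold clock
    rw [← ProcState.phase_eq]
    exact hs.clock_of_visible h
  have ht := eq_time hE hcl.1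
  refine ⟨(E.actor t, E.clock (E.actor t) t / 8), ?_⟩
  rcases hcl.2 with h | h
  · left
    rw [sendTime]
    convert ht using 2
    simp only
    omega
  · right
    rw [recvTime]
    convert ht using 2
    simp only
    omega

/-- A process has announced the invocations of the operations whose write it has performed. -/
lemma mem_announced (hE : E.Live) {t : ℕ} {j : Fin n} {a : TInv A} :
    a ∈ ((E.cfg t).proc j).announced ↔ ∃ k, a = O.tag (j, k) ∧ E.writeTime (j, k) < t := by
  induction t with
  | zero => simp [E.start, Config.initial]
  | succ t ih =>
    have hstep : ((E.cfg (t + 1)).proc j).announced = ((E.cfg t).proc j).announced ∧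
          (∀ k, E.writeTime (j, k) ≠ t) ∨
        ∃ k, E.writeTime (j, k) = t ∧
          ((E.cfg (t + 1)).proc j).announced = ((E.cfg t).proc j).announced ∪ {O.tag (j, k)} := by
      by_cases hact : E.actor t = j
      · obtain ⟨l, -, -, hs⟩ := step_of_actor hact
        by_cases hk : ∃ k, E.writeTime (j, k) = t
        · obtain ⟨k, rfl⟩ := hk
          have hc := (O.steps hE (j, k)).2.1
          have ho := ops_time hE j (m := 8 * k + 3) (by omega)
          change ((E.cfg (E.writeTime (j, k))).proc j).ops = _ at ho
          refine Or.inr ⟨k, rfl, ?_⟩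
          rw [hs.announced_of_write hc, ho, tag, show (8 * k + 3) / 8 = k by omega]
        · push Not at hk
          refine Or.inl ⟨?_, hk⟩
          refine hs.announced_of_ne fun h3 => hk (E.clock j t / 8) ?_
          have hcl := eq_time hE (hs.clock_eq (by omega) (by omega))
          rw [ProcState.phase_eq] at h3
          change E.clock j t % 8 = 3 at h3
          rw [writeTime]
          conv_rhs => rw [hcl]
          congr 1
          simp only
          omega
      · refine Or.inl ⟨by rw [E.idle t j (Ne.symm hact)], fun k hk => hact ?_⟩
        rw [← hk]
        exact (clock_time hE (by simp)).2.2
    rcases hstep with ⟨h, hk⟩ | ⟨k, hk, h⟩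
    · rw [h, ih]
      exact exists_congr fun k => and_congr_right fun _ => by have := hk k; omega
    · rw [h, Set.mem_union, ih, Set.mem_singleton_iff]
      constructor
      · rintro (⟨l, rfl, hl⟩ | rfl)
        · exact ⟨l, rfl, by omega⟩
        · exact ⟨k, rfl, by omega⟩
      · rintro ⟨l, rfl, hl⟩
        rcases (Nat.lt_succ_iff_lt_or_eq.1 hl) with h1 | h1
        · exact Or.inl ⟨l, rfl, h1⟩
        · right
          have := time_inj hE (by omega) (by omega) (h1.trans hk.symm)
          simp only at this
          rw [show l = k by omega]

/-- A view consists of the invocations written before the snapshot. -/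
lemma mem_view (hE : E.Live) {p : Op n} {a : TInv A} :
    a ∈ O.view p ↔ ∃ q, a = O.tag q ∧ E.writeTime q < E.snapTime p := by
  simp [(O.steps hE p).2.2, arr_eq_announced, O.mem_announced hE]

lemma tag_mem_view (hE : E.Live) {p q : Op n} :
    O.tag q ∈ O.view p ↔ E.writeTime q < E.snapTime p := by
  rw [O.mem_view hE]
  constructor
  · rintro ⟨q', h, h'⟩
    rwa [O.tag_injective h]
  · exact fun h => ⟨q, rfl, h⟩

end Ops

lemma writeTime_injective (hE : E.Live) : Function.Injective E.writeTime := by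
  rintro ⟨i, k⟩ ⟨j, l⟩ h
  have := time_inj hE (by omega) (by omega) h
  simp only at this
  exact Prod.ext this.1 (by simp only; omega)

lemma snapTime_injective (hE : E.Live) : Function.Injective E.snapTime := by
  rintro ⟨i, k⟩ ⟨j, l⟩ h
  have := time_inj hE (by omega) (by omega) h
  simp only at this
  exact Prod.ext this.1 (by simp only; omega)

end Execution

/-! ### Words laid out by operations -/

/-- The word `y` consists of the invocations `inv p` and the responses `resp p` of the operations
`p`, which occur at the positions `posI p` and `posR p`, in the right order for each process. -/
structure Layout (y : A.Word) (inv : ∀ p : Op n, A.Inv p.1) (resp : ∀ p : Op n, A.Resp p.1)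
    (posI posR : Op n → ℕ) : Prop where
  inv_eq : ∀ p, y (posI p) = ⟨p.1, Sum.inl (inv p)⟩
  resp_eq : ∀ p, y (posR p) = ⟨p.1, Sum.inr (resp p)⟩
  lt : ∀ p, posI p < posR p
  lt_next : ∀ i k, posR (i, k) < posI (i, k + 1)
  surj : ∀ m, ∃ p, m = posI p ∨ m = posR p

namespace Layout

variable {y : A.Word} {inv : ∀ p : Op n, A.Inv p.1} {resp : ∀ p : Op n, A.Resp p.1}
  {posI posR : Op n → ℕ}

lemma exists_occ (h : Layout y inv resp posI posR) (i : Fin n) :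
    StrictMono (occ y i) ∧ Set.range (occ y i) = {t | (y t).1 = i} ∧
      ∀ k, occ y i (2 * k) = posI (i, k) ∧ occ y i (2 * k + 1) = posR (i, k) := by
  -- `g` lists the positions of the symbols of process `i`, so it is `occ y i`.
  let g : ℕ → ℕ := fun c => if c % 2 = 0 then posI (i, c / 2) else posR (i, c / 2)
  have hg0 : ∀ k, g (2 * k) = posI (i, k) := fun k => by simp [g]
  have hg1 : ∀ k, g (2 * k + 1) = posR (i, k) := fun k => by
    have : (2 * k + 1) / 2 = k := by omega
    simp [g, this]
  have hmono : StrictMono g := by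
    refine strictMono_nat_of_lt_succ fun c => ?_
    obtain ⟨k, rfl | rfl⟩ := Nat.even_or_odd' c
    · rw [hg0, hg1]; exact h.lt _
    · rw [hg1, show 2 * k + 1 + 1 = 2 * (k + 1) by ring, hg0]; exact h.lt_next i k
  have hrange : Set.range g = {t | (y t).1 = i} := by
    ext t
    constructor
    · rintro ⟨c, rfl⟩
      obtain ⟨k, rfl | rfl⟩ := Nat.even_or_odd' c
      · simp [hg0, h.inv_eq]
      · simp [hg1, h.resp_eq]
    · intro ht
      obtain ⟨⟨j, k⟩, rfl | rfl⟩ := h.surj t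
      · simp only [Set.mem_ofPred_eq, h.inv_eq] at ht
        exact ⟨2 * k, by rw [hg0, ht]⟩
      · simp only [Set.mem_ofPred_eq, h.resp_eq] at ht
        exact ⟨2 * k + 1, by rw [hg1, ht]⟩
  have hinf : {t | (y t).1 = i}.Infinite := hrange ▸ Set.infinite_range_of_injective hmono.injective
  have hocc : occ y i = g := by
    refine ((Nat.nth_strictMono hinf).range_inj hmono).1 ?_
    rw [hrange]
    exact Nat.range_nth_of_infinite hinf
  rw [hocc]
  exact ⟨hmono, hrange, fun k => ⟨hg0 k, hg1 k⟩⟩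

lemma invPos_eq (h : Layout y inv resp posI posR) (p : Op n) : invPos y p = posI p :=
  ((h.exists_occ p.1).2.2 p.2).1

lemma respPos_eq (h : Layout y inv resp posI posR) (p : Op n) : respPos y p = posR p :=
  ((h.exists_occ p.1).2.2 p.2).2

lemma wellFormed (h : Layout y inv resp posI posR) : WellFormed y := by
  have hinf : ∀ i, {t | (y t).1 = i}.Infinite := fun i => by
    rw [← (h.exists_occ i).2.1]
    exact Set.infinite_range_of_injective (h.exists_occ i).1.injective
  refine ⟨hinf, fun i k => ?_, fun i k => ?_⟩
  · obtain ⟨c, rfl | rfl⟩ := Nat.even_or_odd' k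
    · rw [((h.exists_occ i).2.2 c).1, h.inv_eq]
      simp
    · rw [((h.exists_occ i).2.2 c).2, h.resp_eq]
      simp
  · refine ⟨occ y i k, ?_⟩
    rw [← Nat.count_eq_card_filter_range, occ, Nat.count_nth_of_infinite (hinf i)]

lemma posI_inj (h : Layout y inv resp posI posR) : Function.Injective posI := by
  rintro ⟨i, k⟩ ⟨j, l⟩ he
  have hij : i = j := by
    have := congrArg (fun t => (y t).1) he
    simpa [h.inv_eq] using this
  subst hij
  rw [← ((h.exists_occ i).2.2 k).1, ← ((h.exists_occ i).2.2 l).1] at he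
  have := (h.exists_occ i).1.injective he
  rw [show k = l by omega]

lemma posR_inj (h : Layout y inv resp posI posR) : Function.Injective posR := by
  rintro ⟨i, k⟩ ⟨j, l⟩ he
  have hij : i = j := by
    have := congrArg (fun t => (y t).1) he
    simpa [h.resp_eq] using this
  subst hij
  rw [← ((h.exists_occ i).2.2 k).2, ← ((h.exists_occ i).2.2 l).2] at he
  have := (h.exists_occ i).1.injective he
  rw [show k = l by omega]

lemma posI_ne_posR (h : Layout y inv resp posI posR) (p q : Op n) : posI p ≠ posR q := by
  intro he
  have h1 := h.inv_eq p
  rw [he, h.resp_eq] at h1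
  simpa using congrArg (fun z : A.Sym => z.2.isLeft) h1

lemma posR_lt_posI_iff (h : Layout y inv resp posI posR) {i : Fin n} {k l : ℕ} :
    posR (i, k) < posI (i, l) ↔ k < l := by
  rw [← ((h.exists_occ i).2.2 k).2, ← ((h.exists_occ i).2.2 l).1,
    (h.exists_occ i).1.lt_iff_lt]
  omega

end Layout

/-! ### The input of an execution -/

lemma exists_lt_of_infinite_increments {f : ℕ → ℕ} (hf : Monotone f)
    (h : {t | f t < f (t + 1)}.Infinite) (m : ℕ) : ∃ t, m < f t := by
  induction m with
  | zero =>
    obtain ⟨t, ht, -⟩ := h.exists_gt 0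
    exact ⟨t + 1, (Nat.zero_le _).trans_lt ht⟩
  | succ m ih =>
    obtain ⟨t, ht⟩ := ih
    obtain ⟨u, hu, htu⟩ := h.exists_gt t
    have hu' : f u < f (u + 1) := hu
    have := hf htu.le
    exact ⟨u + 1, by omega⟩

lemma LocalStep.clock_of_report {i : Fin n} {s s' : ProcState V i} {m m' : V.Mem}
    {a a' : Fin n → Set (TInv A)} {d : Verdict}
    (h : LocalStep V i s m a (.report d) s' m' a') : s'.clock = s.clock + 1 := by
  cases h
  simp [ProcState.clock, Control.phase]

namespace Execution

variable {E : Execution V}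

lemma Fair.live (hE : E.Fair) (hV : V.WaitFree) : E.Live := by
  refine fun i m => exists_lt_of_infinite_increments (E.clock_mono i)
    ((hV E i (hE i)).mono ?_) m
  rintro t ⟨-, d, ht, hd⟩
  obtain ⟨l, -, hl, hs⟩ := step_of_actor ht
  rw [(hl d).2 hd] at hs
  have := hs.clock_of_report
  change E.clock i (t + 1) = E.clock i t + 1 at this
  change E.clock i t < E.clock i (t + 1)
  omega

lemma sendTime_lt_writeTime (hE : E.Live) (p : Op n) : E.sendTime p < E.writeTime p :=
  time_lt_time hE (by omega) (by omega)

lemma snapTime_lt_recvTime (hE : E.Live) (p : Op n) : E.snapTime p < E.recvTime p :=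
  time_lt_time hE (by omega) (by omega)

namespace Ops

variable (O : E.Ops)

/-- A fair execution has an input; it lists the invocations and responses of the operations, and
every invocation in the view of an operation occurs before the response of that operation. -/
lemma exists_input [NeZero n] (hE : E.Live) : ∃ x posI posR, E.IsInput x ∧
    Layout x O.inv O.resp posI posR ∧ ∀ p q, O.tag q ∈ O.view p → posI q < posR p := by
  classical
  -- The input lists the visible steps, so a position is a number of earlier visible steps.
  let S : ℕ → Prop := fun t => (E.label t).sym ≠ none
  have hsend : ∀ p, S (E.sendTime p) := fun p => by simp [S, (O.steps hE p).1]
  have hrecv : ∀ p, S (E.recvTime p) := fun p => by simp [S, O.recv_sym hE p]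
  have hinf : {t | S t}.Infinite := by
    refine (Set.infinite_range_of_injective (f := fun k => E.sendTime (0, k)) ?_).mono ?_
    · intro k l h
      have := time_inj hE (by omega) (by omega) h
      simp only at this
      omega
    · rintro _ ⟨k, rfl⟩
      exact hsend _
  have hx : ∀ m, ∃ z, (E.label (Nat.nth S m)).sym = some z := fun m =>
    Option.ne_none_iff_exists'.1 (Nat.nth_mem_of_infinite hinf m)
  choose x hx using hx
  refine ⟨x, fun p => Nat.count S (E.sendTime p), fun p => Nat.count S (E.recvTime p),
    ⟨Nat.nth S, Nat.nth_strictMono hinf, Nat.range_nth_of_infinite hinf, hx⟩, ?_, ?_⟩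
  · refine ⟨fun p => ?_, fun p => ?_, fun p => ?_, fun i k => ?_, fun m => ?_⟩
    · have := hx (Nat.count S (E.sendTime p))
      rw [Nat.nth_count (hsend p), (O.steps hE p).1] at this
      exact (Option.some.inj this).symm
    · have := hx (Nat.count S (E.recvTime p))
      rw [Nat.nth_count (hrecv p), O.recv_sym hE p] at this
      exact (Option.some.inj this).symm
    · exact Nat.count_strict_mono (hsend p) (time_lt_time hE (by omega) (by omega))
    · exact Nat.count_strict_mono (hrecv _) (time_lt_time hE (by omega) (by simp only; omega))
    · obtain ⟨p, h | h⟩ := exists_of_sym_ne_none hE (Nat.nth_mem_of_infinite hinf m)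
      · exact ⟨p, Or.inl (by simp only [← h]; rw [Nat.count_nth_of_infinite hinf])⟩
      · exact ⟨p, Or.inr (by simp only [← h]; rw [Nat.count_nth_of_infinite hinf])⟩
  · intro p q h
    rw [O.tag_mem_view hE] at h
    have h1 := sendTime_lt_writeTime hE q
    have h2 := snapTime_lt_recvTime hE p
    exact Nat.count_strict_mono (hsend q) (by omega)

/-! ### The sketch of an execution -/

lemma tag_mem_view_self (hE : E.Live) (p : Op n) : O.tag p ∈ O.view p :=
  (O.tag_mem_view hE).2 (time_lt_time hE (by omega) (by omega))

lemma tag_next_notMem_view (hE : E.Live) (i : Fin n) (k : ℕ) :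
    O.tag (i, k + 1) ∉ O.view (i, k) := by
  rw [O.tag_mem_view hE, not_lt]
  exact (time_lt_time hE (by omega) (by simp only; omega)).le

lemma range_view (hE : E.Live) : Set.range O.view = {u | ∃ i k v w, E.HasOp i k v w u} := by
  ext u
  constructor
  · rintro ⟨p, rfl⟩
    exact ⟨_, _, _, _, O.hasOp p⟩
  · rintro ⟨i, k, v, w, h⟩
    exact ⟨(i, k), (O.eq_of_hasOp hE h).2.2.symm⟩

/-- In a sketch, the invocations that occur before the response of an operation are exactly those
in the view of the operation. -/
lemma layout_of_isSketch (hE : E.Live) {y : A.Word} (hy : E.IsSketch y) :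
    ∃ posI posR, Layout y O.inv O.resp posI posR ∧
      ∀ p q, posI q < posR p ↔ O.tag q ∈ O.view p := by
  obtain ⟨views, I, R, hmono, hrange, hI, hR, hy⟩ := hy
  rw [← O.range_view hE] at hrange
  -- Round `k` starts at position `L k`; the invocation of `q` is entry `jI q` of round `kI q`,
  -- and the response of `p` is entry `jR p` of round `kR p`.
  let L : ℕ → ℕ := fun k => (sketchPrefix I R k).length
  have hL : ∀ k, L (k + 1) = L k + (I k).length + (R k).length := fun k => by
    simp [L, sketchPrefix]; ring
  have hyI : ∀ k j (hj : j < (I k).length),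
      y (L k + j) = ⟨(I k)[j].1, Sum.inl (I k)[j].2.2⟩ := fun k j hj => by
    rw [hy (k + 1) (L k + j) (by change _ < L (k + 1); rw [hL]; omega)]
    simp [sketchPrefix, L, hj]
  have hyR : ∀ k j (hj : j < (R k).length),
      y (L k + (I k).length + j) = ⟨(R k)[j].1, Sum.inr (R k)[j].2.2⟩ := fun k j hj => by
    rw [hy (k + 1) (L k + (I k).length + j) (by change _ < L (k + 1); rw [hL]; omega)]
    simp [sketchPrefix, L, Nat.add_assoc]
  have hview : ∀ p, ∃ k, O.view p = views k := fun p => by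
    have : O.view p ∈ Set.range views := hrange ▸ ⟨p, rfl⟩
    exact this.imp fun _ => Eq.symm
  have hIex : ∀ q, ∃ k j, ∃ hj : j < (I k).length, (I k)[j] = O.tag q := by
    classical
    intro q
    have hex : ∃ k, O.tag q ∈ views k := by
      obtain ⟨k, hk⟩ := hview q
      exact ⟨k, hk ▸ O.tag_mem_view_self hE q⟩
    obtain ⟨j, hj, hjt⟩ := List.mem_iff_getElem.1 (((hI (Nat.find hex)).2 (O.tag q)).2
      ⟨Nat.find_spec hex, fun _ => Nat.find_min hex⟩)
    exact ⟨_, j, hj, hjt⟩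
  have hRex : ∀ p : Op n, ∃ k j, ∃ hj : j < (R k).length,
      (R k)[j] = ⟨p.1, p.2, O.resp p⟩ := by
    intro p
    obtain ⟨k, hk⟩ := hview p
    obtain ⟨j, hj, hjt⟩ := List.mem_iff_getElem.1 (((hR k).2 ⟨p.1, p.2, O.resp p⟩).2
      ⟨O.inv p, hk ▸ O.hasOp p⟩)
    exact ⟨k, j, hj, hjt⟩
  choose kI jI hjI htI using hIex
  choose kR jR hjR htR using hRex
  have hkI : ∀ q, O.tag q ∈ views (kI q) ∧ ∀ j < kI q, O.tag q ∉ views j := fun q =>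
    ((hI (kI q)).2 _).1 (htI q ▸ List.getElem_mem _)
  have hkR : ∀ p, O.view p = views (kR p) := fun p => by
    obtain ⟨v, hv⟩ := ((hR (kR p)).2 ⟨p.1, p.2, O.resp p⟩).1 (htR p ▸ List.getElem_mem _)
    exact (O.eq_of_hasOp hE hv).2.2.symm
  have hLmono : Monotone L := monotone_nat_of_le_succ fun k => by rw [hL]; omega
  -- The round of an invocation is the first one whose view contains it, so it comes no later than
  -- round `kR p` if and only if `O.view p` contains it; invocations come first in a round.
  have hlt : ∀ p q, L (kI q) + jI q < L (kR p) + (I (kR p)).length + jR p ↔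
      O.tag q ∈ O.view p := by
    intro p q
    rw [hkR p]
    have h1 := hjI q
    have h2 := hjR p
    constructor
    · intro h
      by_contra hn
      have hlt : kR p < kI q := by
        by_contra hle
        exact hn (hmono.monotone (not_lt.1 hle) (hkI q).1)
      have := hLmono (Nat.succ_le_of_lt hlt)
      rw [Nat.succ_eq_add_one, hL] at this
      omega
    · intro h
      have hle : kI q ≤ kR p := by
        by_contra hlt
        exact (hkI q).2 _ (not_le.1 hlt) h
      rcases hle.eq_or_lt with he | hlt
      · rw [he] at h1 ⊢
        omega
      · have := hLmono (Nat.succ_le_of_lt hlt)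
        rw [Nat.succ_eq_add_one, hL] at this
        omega
  have hinv : ∀ q, y (L (kI q) + jI q) = ⟨q.1, Sum.inl (O.inv q)⟩ := fun q => by
    rw [hyI _ _ (hjI q), htI q]
    rfl
  have hresp : ∀ p, y (L (kR p) + (I (kR p)).length + jR p) = ⟨p.1, Sum.inr (O.resp p)⟩ :=
    fun p => by rw [hyR _ _ (hjR p), htR p]
  refine ⟨fun q => L (kI q) + jI q, fun p => L (kR p) + (I (kR p)).length + jR p,
    ⟨hinv, hresp, fun p => (hlt p p).2 (O.tag_mem_view_self hE p), fun i k => ?_, fun m => ?_⟩, hlt⟩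
  · refine lt_of_le_of_ne (not_lt.1 ((hlt _ _).not.2 (O.tag_next_notMem_view hE i k)))
      fun he => ?_
    have h1 := hinv (i, k + 1)
    rw [← he, hresp] at h1
    simp at h1
  · -- Every round has a response, so the rounds cover all positions.
    have hRne : ∀ k, 0 < (R k).length := fun k => by
      have : views k ∈ Set.range O.view := hrange ▸ ⟨k, rfl⟩
      obtain ⟨p, hp⟩ := this
      exact List.length_pos_of_mem (((hR k).2 ⟨p.1, p.2, O.resp p⟩).2
        ⟨O.inv p, hp ▸ O.hasOp p⟩)
    have hex : ∃ k, m < L (k + 1) :=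
      ⟨m, (StrictMono.le_apply (strictMono_nat_of_lt_succ fun k => by
        have := hRne k; rw [hL]; omega : StrictMono L)).trans_lt' (Nat.lt_succ_self m)⟩
    classical
    have hspec := Nat.find_spec hex
    have hle : L (Nat.find hex) ≤ m := by
      rcases hk : Nat.find hex with _ | k
      · simp [L, sketchPrefix]
      · exact not_lt.1 (Nat.find_min hex (m := k) (by omega))
    generalize Nat.find hex = k at hspec hle
    rw [hL] at hspec
    by_cases hj : m - L k < (I k).length
    · have hmem := ((hI k).2 (I k)[m - L k]).1 (List.getElem_mem _)
      have hk : views k ∈ Set.range O.view := hrange ▸ ⟨k, rfl⟩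
      obtain ⟨p, hp⟩ := hk
      obtain ⟨q, hq, -⟩ := (O.mem_view hE).1 (hp ▸ hmem.1)
      refine ⟨q, Or.inl ?_⟩
      rw [hq] at hmem
      have hkq : kI q = k := by
        rcases lt_trichotomy (kI q) k with h | h | h
        · exact absurd (hkI q).1 (hmem.2 _ h)
        · exact h
        · exact absurd hmem.1 ((hkI q).2 _ h)
      have hjq := hjI q
      have htq := htI q
      simp only [hkq] at hjq htq ⊢
      have := ((hI k).1.getElem_inj_iff (hi := hjq) (hj := hj)).1 (htq.trans hq.symm)
      omega
    · have hj' : m - L k - (I k).length < (R k).length := by omega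
      have hb : ∀ b ∈ R k, ∃ p, b = ⟨p.1, p.2, O.resp p⟩ ∧ O.view p = views k := by
        rintro ⟨i, l, w⟩ hb
        obtain ⟨v, hv⟩ := ((hR k).2 _).1 hb
        obtain ⟨-, hw, hu⟩ := O.eq_of_hasOp hE hv
        exact ⟨(i, l), by simp only at hw; rw [hw], hu.symm⟩
      obtain ⟨p, hp, hpv⟩ := hb _ (List.getElem_mem hj')
      refine ⟨p, Or.inr ?_⟩
      have hkp : kR p = k := hmono.injective ((hkR _).symm.trans hpv)
      have hjp := hjR p
      have htp := htR p
      simp only [hkp] at hjp htp ⊢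
      have := ((hR k).1.getElem_inj_iff (hi := hjp) (hj := hj')).1 (htp.trans hp.symm)
      omega

end Ops
end Execution

lemma sketchPrefix_isPrefix (I : ℕ → List (TInv A)) (R : ℕ → List (TResp A)) {k l : ℕ}
    (h : k ≤ l) : sketchPrefix I R k <+: sketchPrefix I R l := by
  induction l, h using Nat.le_induction with
  | base => exact List.prefix_rfl
  | succ l _ ih =>
    refine ih.trans ?_
    rw [sketchPrefix, List.append_assoc]
    exact List.prefix_append _ _

namespace Execution

variable {E : Execution V}

namespace Ops

variable (O : E.Ops)

lemma finite_view (hE : E.Live) (p : Op n) : (O.view p).Finite := by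
  refine (((Set.finite_Iio (E.snapTime p)).preimage
    (writeTime_injective hE).injOn).image O.tag).subset ?_
  intro a ha
  obtain ⟨q, rfl, hq⟩ := (O.mem_view hE).1 ha
  exact ⟨q, hq, rfl⟩

lemma view_subset_total (hE : E.Live) (p q : Op n) : O.view p ⊆ O.view q ∨ O.view q ⊆ O.view p := by
  have key : ∀ p q, E.snapTime p ≤ E.snapTime q → O.view p ⊆ O.view q := by
    intro p q h a ha
    obtain ⟨r, rfl, hr⟩ := (O.mem_view hE).1 ha
    exact (O.mem_view hE).2 ⟨r, rfl, hr.trans_le h⟩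
  exact (le_total _ _).imp (key p q) (key q p)

end Ops

lemma Live.exists_isSketch [NeZero n] (hE : E.Live) : ∃ y, E.IsSketch y := by
  classical
  obtain ⟨O⟩ := hE.nonempty_ops
  -- The views form a chain of finite sets, so they are enumerated by their cardinalities.
  let C : ℕ → Prop := fun c => ∃ p, (O.view p).ncard = c
  have hC : {c | C c}.Infinite := by
    refine Set.infinite_of_forall_exists_gt fun k => ⟨_, ⟨(0, k), rfl⟩, ?_⟩
    have hsub : (fun j => O.tag (0, j)) '' (Finset.range (k + 1) : Set ℕ) ⊆ O.view (0, k) := by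
      rintro _ ⟨j, hj, rfl⟩
      rw [Finset.coe_range, Set.mem_Iio] at hj
      exact (O.tag_mem_view hE).2 (time_lt_time hE (by omega) (by simp only; omega))
    have hcard := Set.ncard_le_ncard hsub (O.finite_view hE _)
    rw [Set.ncard_image_of_injective _ fun i j h => by simpa using O.tag_injective h,
      Set.ncard_coe_finset, Finset.card_range] at hcard
    omega
  choose p hp using fun k => Nat.nth_mem_of_infinite hC k
  have hmono : StrictMono fun k => O.view (p k) := by
    intro k l hkl
    have hlt : (O.view (p k)).ncard < (O.view (p l)).ncard := by
      rw [hp, hp]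
      exact Nat.nth_strictMono hC hkl
    have hns : ¬ O.view (p l) ⊆ O.view (p k) := fun h =>
      (Set.ncard_le_ncard h (O.finite_view hE _)).not_gt hlt
    exact ⟨(O.view_subset_total hE _ _).resolve_right hns, hns⟩
  have hrange : Set.range (fun k => O.view (p k)) = Set.range O.view := by
    apply subset_antisymm
    · rintro _ ⟨k, rfl⟩
      exact ⟨p k, rfl⟩
    · rintro _ ⟨q, rfl⟩
      have hq : C (O.view q).ncard := ⟨q, rfl⟩
      refine ⟨Nat.count C (O.view q).ncard, ?_⟩
      have hcard := hp (Nat.count C (O.view q).ncard)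
      rw [Nat.nth_count hq] at hcard
      rcases O.view_subset_total hE (p (Nat.count C (O.view q).ncard)) q with h | h
      · exact Set.eq_of_subset_of_ncard_le h hcard.ge (O.finite_view hE _)
      · exact (Set.eq_of_subset_of_ncard_le h hcard.le (O.finite_view hE _)).symm
  have hIfin : ∀ k, {a | a ∈ O.view (p k) ∧ ∀ j < k, a ∉ O.view (p j)}.Finite := fun k =>
    (O.finite_view hE (p k)).subset fun a ha => ha.1
  have hRfin : ∀ k, {b : TResp A | ∃ v, E.HasOp b.1 b.2.1 v b.2.2 (O.view (p k))}.Finite := by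
    intro k
    refine (((O.finite_view hE (p k)).preimage O.tag_injective.injOn).image
      fun q => (⟨q.1, q.2, O.resp q⟩ : TResp A)).subset ?_
    rintro ⟨i, l, w⟩ ⟨v, hv⟩
    obtain ⟨-, hw, hu⟩ := O.eq_of_hasOp hE hv
    simp only at hw hu
    refine ⟨(i, l), ?_, by rw [hw]⟩
    rw [Set.mem_preimage, hu]
    exact O.tag_mem_view_self hE _
  let I : ℕ → List (TInv A) := fun k => (hIfin k).toFinset.toList
  let R : ℕ → List (TResp A) := fun k => (hRfin k).toFinset.toList
  have hRne : ∀ k, 0 < (R k).length := fun k => by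
    refine List.length_pos_of_mem (a := ⟨(p k).1, (p k).2, O.resp (p k)⟩) ?_
    simp only [R, Finset.mem_toList, Set.Finite.mem_toFinset]
    exact ⟨_, O.hasOp (p k)⟩
  have hlen : ∀ k, k ≤ (sketchPrefix I R k).length := by
    intro k
    induction k with
    | zero => exact Nat.zero_le _
    | succ k ih =>
      have := hRne k
      simp only [sketchPrefix, List.length_append, List.length_map]
      omega
  refine ⟨fun t => (sketchPrefix I R (t + 1))[t]'(hlen (t + 1)), fun k => O.view (p k), I, R,
    hmono, hrange.trans (O.range_view hE), fun k => ⟨Finset.nodup_toList _, fun a => ?_⟩,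
    fun k => ⟨Finset.nodup_toList _, fun b => ?_⟩, fun k t ht => ?_⟩
  · simp [I]
  · simp [R]
  · rcases le_total (t + 1) k with h | h
    · exact (sketchPrefix_isPrefix I R h).getElem _
    · exact ((sketchPrefix_isPrefix I R h).getElem _).symm

end Execution

/-! ### Reordering the steps of an execution -/

/-- A step of a process does not depend on the memory of the algorithm unless it is in a block, and
it does not depend on the shared array unless it is a snapshot. -/
lemma LocalStep.transfer {i : Fin n} {s s' : ProcState V i} {m m' M M' : V.Mem}
    {a a' b b' : Fin n → Set (TInv A)} {l : Label A i} (h : LocalStep V i s m a l s' m' a')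
    (hm : s'.clock = s.clock → M = m ∧ M' = m') (hm' : s'.clock = s.clock + 1 → M' = M)
    (hb : b i = s.announced) (hb' : b' = Function.update b i s'.announced)
    (hsnap : s.ctrl.phase = 6 → ⋃ j, b j = ⋃ j, a j) : LocalStep V i s M b l s' M' b' := by
  have hupd : ∀ u, s'.announced = u → s.announced = u → b' = b := fun u h1 h2 => by
    rw [hb', h1, ← h2, ← hb, Function.update_eq_self]
  cases h with
  | pick l k u _ _ v =>
    obtain rfl := hm' (by simp [ProcState.clock, Control.phase])
    obtain rfl := hupd _ rfl rfl
    exact .pick ..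
  | pre l k u _ _ v f h =>
    obtain ⟨rfl, rfl⟩ := hm (by simp [ProcState.clock, Control.phase])
    obtain rfl := hupd _ rfl rfl
    exact .pre _ _ _ _ _ _ _ h
  | send l k u _ _ v h =>
    obtain rfl := hm' (by simp [ProcState.clock, Control.phase])
    obtain rfl := hupd _ rfl rfl
    exact .send _ _ _ _ _ _ h
  | write l k u _ _ v =>
    obtain rfl := hm' (by simp [ProcState.clock, Control.phase])
    subst hb'
    exact .write ..
  | forward l k u _ _ v =>
    obtain rfl := hm' (by simp [ProcState.clock, Control.phase])
    obtain rfl := hupd _ rfl rfl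
    exact .forward ..
  | answer l k u _ _ v w =>
    obtain rfl := hm' (by simp [ProcState.clock, Control.phase])
    obtain rfl := hupd _ rfl rfl
    exact .answer ..
  | snapshot l k u _ _ v w =>
    obtain rfl := hm' (by simp [ProcState.clock, Control.phase])
    obtain rfl := hupd _ rfl rfl
    rw [← hsnap rfl]
    exact .snapshot ..
  | receive l k u _ _ v w view =>
    obtain rfl := hm' (by simp [ProcState.clock, Control.phase]; ring)
    obtain rfl := hupd _ rfl rfl
    exact .receive ..
  | post l k u _ _ f h =>
    obtain ⟨rfl, rfl⟩ := hm (by simp [ProcState.clock, Control.phase])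
    obtain rfl := hupd _ rfl rfl
    exact .post _ _ _ _ _ _ h
  | report l k u _ _ h =>
    obtain rfl := hm' (by simp [ProcState.clock, Control.phase])
    obtain rfl := hupd _ rfl rfl
    exact .report _ _ _ _ _ h

namespace Execution

variable {E : Execution V}

/-- The step at time `t` is an operation on the memory of the algorithm. -/
def IsMemStep (E : Execution V) (t : ℕ) : Prop :=
  E.clock (E.actor t) (t + 1) = E.clock (E.actor t) t

lemma mem_eq_of_no_memStep {t t' : ℕ} (htt : t ≤ t')
    (h : ∀ u, t ≤ u → u < t' → ¬ E.IsMemStep u) : (E.cfg t').mem = (E.cfg t).mem := by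
  induction t', htt using Nat.le_induction with
  | base => rfl
  | succ u hu ih =>
    rw [← ih fun v hv hv' => h v hv (by omega)]
    rcases (E.step u).clock_cases with h1 | h1
    · exact absurd h1.1 (h u hu (by omega))
    · exact h1.2

/-- The steps of a fair execution may be permuted, as long as the order of the steps of each
process, the order of the operations on the memory, and the order between the writes and the
snapshots of the timed adversary are preserved. Here `σ t` is the new time of the step at `t`. -/
theorem exists_permuted (O : E.Ops) (hE : E.Live) (hF : E.Fair) (σ : ℕ ≃ ℕ)
    (hproc : ∀ u t, E.actor u = E.actor t → u < t → σ u < σ t)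
    (hmem : ∀ u t, E.IsMemStep u → E.IsMemStep t → u < t → σ u < σ t)
    (hview : ∀ p q, σ (E.writeTime q) < σ (E.snapTime p) ↔ E.writeTime q < E.snapTime p) :
    ∃ E' : Execution V, E'.Fair ∧ E'.Indist E ∧
      ∀ s, (E'.label s).sym = (E.label (σ.symm s)).sym := by
  classical
  -- At time `s` of the new execution, process `i` is in its state at time `τ s i` of `E`, after the
  -- same number of its own steps, and the memory is as in `E` at time `g s`, just after the last
  -- operation on the memory that has been performed.
  let act : ℕ → Fin n := fun s => E.actor (σ.symm s)
  let τ : ℕ → Fin n → ℕ := fun s i =>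
    Nat.nth (fun t => E.actor t = i) (Nat.count (fun s => act s = i) s)
  let g : ℕ → ℕ := fun s =>
    (Finset.range s).sup fun s' => if E.IsMemStep (σ.symm s') then σ.symm s' + 1 else 0
  have hact : ∀ i, {s | act s = i}.Infinite := fun i =>
    (hF i).preimage (f := σ.symm) (by simp)
  have hnth : ∀ i c, Nat.nth (fun t => E.actor t = i) c =
      σ.symm (Nat.nth (fun s => act s = i) c) := by
    intro i
    refine congrFun (((Nat.nth_strictMono (hF i)).range_inj ?_).1 ?_)
    · intro c d hcd
      have h1 := Nat.nth_strictMono (hact i) hcd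
      have hc : act (Nat.nth (fun s => act s = i) c) = i := Nat.nth_mem_of_infinite (hact i) c
      have hd : act (Nat.nth (fun s => act s = i) d) = i := Nat.nth_mem_of_infinite (hact i) d
      change σ.symm _ < σ.symm _
      generalize Nat.nth (fun s => act s = i) c = s at h1 hc
      generalize Nat.nth (fun s => act s = i) d = s' at h1 hd
      rcases lt_trichotomy (σ.symm s) (σ.symm s') with h | h | h
      · exact h
      · exact absurd (σ.symm.injective h) h1.ne
      · have := hproc _ _ (hd.trans hc.symm) h
        simp only [Equiv.apply_symm_apply] at this
        omega
    · rw [Nat.range_nth_of_infinite (hF i)]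
      have := Nat.range_nth_of_infinite (hact i)
      ext t
      have ht := Set.ext_iff.1 this (σ t)
      simp only [Set.mem_range, Set.mem_ofPred_eq, act, Equiv.symm_apply_apply] at ht ⊢
      rw [← ht]
      simp [Equiv.symm_apply_eq]
  have hτ : ∀ s, τ s (act s) = σ.symm s := fun s => by
    simp only [τ]
    rw [hnth, Nat.nth_count (p := fun s' => act s' = act s) rfl]
  have hτ_succ : ∀ s j, j ≠ act s → τ (s + 1) j = τ s j := fun s j hj => by
    simp only [τ]
    rw [Nat.count_succ, if_neg (Ne.symm hj), add_zero]
  have hidle : ∀ i c, (E.cfg (Nat.nth (fun t => E.actor t = i) (c + 1))).proc i =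
      (E.cfg (Nat.nth (fun t => E.actor t = i) c + 1)).proc i := by
    intro i c
    refine proc_eq_of_idle (Nat.nth_strictMono (hF i) (Nat.lt_succ_self c)) fun u hu hu' ha => ?_
    rw [← Nat.nth_count (p := fun t => E.actor t = i) ha] at hu hu'
    have h1 := (Nat.nth_strictMono (hF i)).lt_iff_lt.1 (Nat.lt_of_succ_le hu)
    have h2 := (Nat.nth_strictMono (hF i)).lt_iff_lt.1 hu'
    omega
  have hproc_succ : ∀ s, (E.cfg (τ (s + 1) (act s))).proc (act s) =
      (E.cfg (σ.symm s + 1)).proc (act s) := fun s => by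
    rw [← hτ]
    simp only [τ]
    rw [Nat.count_succ, if_pos rfl, hidle]
  have hproc_zero : ∀ i, (E.cfg (τ 0 i)).proc i = (E.cfg 0).proc i := fun i => by
    refine proc_eq_of_idle (Nat.zero_le _) fun u _ hu ha => ?_
    rw [← Nat.nth_count (p := fun t => E.actor t = i) ha] at hu
    have := (Nat.nth_strictMono (hF i)).lt_iff_lt.1 hu
    simp at this
  have hτ_lt : ∀ u s, u < τ s (E.actor u) ↔ σ u < s := by
    intro u s
    have hu : act (σ u) = E.actor u := by simp [act]
    have h1 : u = Nat.nth (fun t => E.actor t = E.actor u)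
        (Nat.count (fun s => act s = E.actor u) (σ u)) := by
      rw [hnth, Nat.nth_count (p := fun s => act s = E.actor u) hu, Equiv.symm_apply_apply]
    simp only [τ]
    conv_lhs => lhs; rw [h1]
    rw [(Nat.nth_strictMono (hF _)).lt_iff_lt]
    constructor
    · intro h
      by_contra hle
      exact (Nat.count_monotone _ (not_lt.1 hle)).not_gt h
    · exact fun h => Nat.count_strict_mono hu h
  have hg : ∀ s, E.IsMemStep (σ.symm s) → (E.cfg (g s)).mem = (E.cfg (σ.symm s)).mem ∧
      g (s + 1) = σ.symm s + 1 := by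
    intro s hs
    have hle : g s ≤ σ.symm s := by
      refine Finset.sup_le fun s' hs' => ?_
      split_ifs with h
      · by_contra hlt
        rcases (Nat.lt_succ_iff_lt_or_eq.1 (not_le.1 hlt)) with h1 | h1
        · have := hmem _ _ hs h h1
          simp only [Equiv.apply_symm_apply, Finset.mem_range] at this hs'
          omega
        · have := σ.symm.injective h1
          simp only [Finset.mem_range] at hs'
          omega
      · exact Nat.zero_le _
    refine ⟨(mem_eq_of_no_memStep hle fun u hu hu' hum => ?_).symm, ?_⟩
    · have h1 := hmem _ _ hum hs hu'
      rw [Equiv.apply_symm_apply] at h1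
      have h2 := Finset.le_sup (f := fun s' => if E.IsMemStep (σ.symm s') then σ.symm s' + 1 else 0)
        (Finset.mem_range.2 h1)
      simp only [Equiv.symm_apply_apply, if_pos hum] at h2
      exact absurd (h2.trans hu) (by omega)
    · simp only [g, Finset.range_add_one, Finset.sup_insert, if_pos hs]
      exact max_eq_left (hle.trans (Nat.le_succ _))
  have hg' : ∀ s, ¬ E.IsMemStep (σ.symm s) → g (s + 1) = g s := by
    intro s hs
    simp only [g, Finset.range_add_one, Finset.sup_insert, if_neg hs]
    exact max_eq_right (Nat.zero_le _)
  let E' : Execution V :=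
    { cfg := fun s =>
        { proc := fun i => (E.cfg (τ s i)).proc i
          mem := (E.cfg (g s)).mem
          arr := fun j => ((E.cfg (τ s j)).proc j).announced }
      actor := act
      label := fun s => E.label (σ.symm s)
      start := by
        have h0 : g 0 = 0 := by simp [g]
        simp only [hproc_zero, h0, E.start]
        rfl
      step := by
        intro s
        simp only
        rw [hproc_succ, hτ]
        refine (E.step (σ.symm s)).transfer (fun h => ?_) (fun h => ?_) ?_ ?_ fun h => ?_
        · rw [(hg s h).2]
          exact ⟨(hg s h).1, rfl⟩
        · rw [hg' s fun h' => ?_]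
          have h1 : E.clock (act s) (σ.symm s + 1) = E.clock (act s) (σ.symm s) := h'
          have h2 : E.clock (act s) (σ.symm s + 1) = E.clock (act s) (σ.symm s) + 1 := h
          omega
        · rw [show E.actor (σ.symm s) = act s from rfl, hτ]
        · funext j
          by_cases hj : j = act s
          · subst hj
            rw [hproc_succ, show act s = E.actor (σ.symm s) from rfl, Function.update_self]
          · rw [Function.update_of_ne hj, hτ_succ s j hj]
        · -- The snapshot returns what has been announced, and `hview` says that this is the same
          -- as in `E`.
          have hst := (E.step (σ.symm s)).clock_eq (by omega) (by omega)
          rw [ProcState.phase_eq] at h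
          change E.clock _ _ % 8 = 6 at h
          have hs : σ.symm s = E.snapTime (act s, E.clock (act s) (σ.symm s) / 8) := by
            refine (eq_time hE hst).trans ?_
            rw [snapTime]
            congr 1
            change E.clock (act s) (σ.symm s) = _
            change E.clock (act s) (σ.symm s) % 8 = 6 at h
            simp only
            omega
          refine Set.iUnion_congr fun j => ?_
          rw [arr_eq_announced]
          ext a
          rw [O.mem_announced hE, O.mem_announced hE]
          refine exists_congr fun k => and_congr_right fun _ => ?_
          have hw : E.actor (E.writeTime (j, k)) = j := (clock_time hE (by simp)).2.2
          have h1 := hτ_lt (E.writeTime (j, k)) s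
          rw [hw] at h1
          rw [h1]
          conv_rhs => rw [hs]
          rw [← hview, ← hs, Equiv.apply_symm_apply]
      idle := by
        intro s j hj
        simp only
        rw [hτ_succ s j hj] }
  refine ⟨E', hact, fun i k => ?_, fun s => rfl⟩
  have h1 : Nat.count (fun s => act s = i) (Nat.nth (fun s => act s = i) k + 1) = k + 1 := by
    rw [Nat.count_succ, Nat.count_nth_of_infinite (hact i),
      if_pos (Nat.nth_mem_of_infinite (hact i) k)]
  change (E.cfg (τ (Nat.nth (fun s => act s = i) k + 1) i)).proc i = _
  simp only [τ]
  rw [h1, hidle]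
  rfl

end Execution

/-- Listing the natural numbers in the order of their keys. -/
lemma exists_equiv_of_key {α : Type*} [LinearOrder α] {key : ℕ → α}
    (hinj : Function.Injective key) (hfin : ∀ t, {u | key u < key t}.Finite) :
    ∃ σ : ℕ ≃ ℕ, ∀ u t, key u < key t → σ u < σ t := by
  classical
  -- The new place of `t` is its place in the list of the ranks `r t`.
  let r : ℕ → ℕ := fun t => {u | key u < key t}.ncard
  have hr : ∀ u t, key u < key t → r u < r t := fun u t h =>
    Set.ncard_lt_ncard ⟨fun v hv => lt_trans hv h, fun hs => lt_irrefl _ (hs h)⟩ (hfin t)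
  have hrinj : Function.Injective r := by
    intro u t h
    rcases lt_trichotomy (key u) (key t) with h1 | h1 | h1
    · exact absurd h (hr _ _ h1).ne
    · exact hinj h1
    · exact absurd h (hr _ _ h1).ne'
  let S : ℕ → Prop := fun c => ∃ t, r t = c
  have hS : {c | S c}.Infinite := Set.infinite_range_of_injective hrinj
  have hbij : Function.Bijective fun t => Nat.count S (r t) := by
    constructor
    · intro u t h
      exact hrinj (Nat.count_injective ⟨u, rfl⟩ ⟨t, rfl⟩ h)
    · intro m
      obtain ⟨t, ht⟩ := Nat.nth_mem_of_infinite hS m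
      exact ⟨t, by simp only [ht, Nat.count_nth_of_infinite hS]⟩
  exact ⟨Equiv.ofBijective _ hbij, fun u t h => Nat.count_strict_mono ⟨u, rfl⟩ (hr _ _ h)⟩

namespace Execution

variable {E : Execution V}

/-- The step at time `t` is neither a step of the timed adversary nor the sending of an
invocation. -/
def IsOrdinary (E : Execution V) (t : ℕ) : Prop :=
  E.IsMemStep t ∨ E.clock (E.actor t) t % 8 < 2

lemma eq_time_of_not_isOrdinary (hE : E.Live) {t : ℕ} (h : ¬ E.IsOrdinary t) :
    ∃ (p : Op n) (r : ℕ), 2 ≤ r ∧ r ≤ 7 ∧ t = E.time p.1 (8 * p.2 + r) ∧ E.actor t = p.1 ∧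
      E.clock p.1 t = 8 * p.2 + r := by
  rw [IsOrdinary, not_or] at h
  refine ⟨(E.actor t, E.clock (E.actor t) t / 8), E.clock (E.actor t) t % 8, by omega, by omega,
    ?_, rfl, by simp only; omega⟩
  simp only [Nat.div_add_mod]
  refine eq_time hE ?_
  rcases E.clock_succ (E.actor t) t with h1 | h1
  · exact absurd h1 h.1
  · exact h1.1

/-- In the sketch, a step of an operation acts at the position of the invocation up to the
response of the inner adversary, and at the position of the response from the snapshot on. -/
noncomputable def stepPos (E : Execution V) (posI posR : Op n → ℕ) (t : ℕ) : ℕ :=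
  if E.clock (E.actor t) t % 8 ≤ 5 then posI (E.actor t, E.clock (E.actor t) t / 8)
  else posR (E.actor t, E.clock (E.actor t) t / 8)

/-- The time of the first snapshot whose response is at position `m` of the sketch or later. -/
noncomputable def snapFrom (E : Execution V) (posR : Op n → ℕ) (m : ℕ) : ℕ :=
  sInf {t | ∃ p, m ≤ posR p ∧ E.snapTime p = t}

open Classical in
/-- Sorting the steps of an execution by this key makes the input equal to the sketch. The steps
of the timed adversary that belong to position `m` of the sketch are placed at the
time of the first snapshot whose response is at position `m` or later, those for
smaller positions first; the other steps keep their times. The last entry breaks ties. -/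
noncomputable def sortKey (E : Execution V) (posI posR : Op n → ℕ) (t : ℕ) : ℕ ×ₗ ℕ ×ₗ ℕ :=
  if E.IsOrdinary t then toLex (t, toLex (0, t))
  else toLex (E.snapFrom posR (E.stepPos posI posR t), toLex (E.stepPos posI posR t, t))

section

variable {O : E.Ops} {y : A.Word} {posI posR : Op n → ℕ}

lemma snapFrom_mem (hL : Layout y O.inv O.resp posI posR) (m : ℕ) :
    ∃ p, m ≤ posR p ∧ E.snapTime p = E.snapFrom posR m := by
  have : {t | ∃ p, m ≤ posR p ∧ E.snapTime p = t}.Nonempty := by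
    obtain ⟨p, h | h⟩ := hL.surj m
    · exact ⟨_, p, by have := hL.lt p; omega, rfl⟩
    · exact ⟨_, p, h.le, rfl⟩
  exact Nat.sInf_mem this

lemma snapFrom_le (posR : Op n → ℕ) {m : ℕ} {p : Op n} (h : m ≤ posR p) :
    E.snapFrom posR m ≤ E.snapTime p :=
  Nat.sInf_le ⟨p, h, rfl⟩

lemma snapFrom_mono (hL : Layout y O.inv O.resp posI posR) : Monotone (E.snapFrom posR) := by
  intro l m h
  obtain ⟨p, hp, hp'⟩ := snapFrom_mem hL m
  exact hp' ▸ snapFrom_le posR (h.trans hp)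

lemma writeTime_lt_snapFrom (hE : E.Live) (hL : Layout y O.inv O.resp posI posR)
    (hv : ∀ p q, posI q < posR p ↔ O.tag q ∈ O.view p) (q : Op n) :
    E.writeTime q < E.snapFrom posR (posI q) := by
  obtain ⟨p, hp, hp'⟩ := snapFrom_mem hL (posI q)
  rw [← hp', ← O.tag_mem_view hE, ← hv]
  exact lt_of_le_of_ne hp (hL.posI_ne_posR q p)

lemma stepPos_time (hE : E.Live) (posI posR : Op n → ℕ) (p : Op n) {r : ℕ} (h2 : 2 ≤ r)
    (h7 : r ≤ 7) :
    E.stepPos posI posR (E.time p.1 (8 * p.2 + r)) = if r ≤ 5 then posI p else posR p := by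
  obtain ⟨h, -, h'⟩ := clock_time hE (i := p.1) (m := 8 * p.2 + r) (by omega)
  rw [stepPos, h', h, show (8 * p.2 + r) % 8 = r by omega, show (8 * p.2 + r) / 8 = p.2 by omega]

lemma not_isOrdinary_time (hE : E.Live) (p : Op n) {r : ℕ} (h2 : 2 ≤ r) (h7 : r ≤ 7) :
    ¬ E.IsOrdinary (E.time p.1 (8 * p.2 + r)) := by
  obtain ⟨h, h'', h'⟩ := clock_time hE (i := p.1) (m := 8 * p.2 + r) (by omega)
  rw [IsOrdinary, IsMemStep, h', h, h'']
  omega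

lemma sortKey_injective (E : Execution V) (posI posR : Op n → ℕ) :
    Function.Injective (E.sortKey posI posR) := by
  have h : ∀ t, (ofLex (ofLex (E.sortKey posI posR t)).2).2 = t := fun t => by
    rw [sortKey]
    split_ifs <;> rfl
  intro u t hut
  rw [← h t, ← hut, h u]

lemma sortKey_lt_of_stepPos_lt (hL : Layout y O.inv O.resp posI posR) {u t : ℕ}
    (hu : ¬ E.IsOrdinary u) (ht : ¬ E.IsOrdinary t)
    (h : E.stepPos posI posR u < E.stepPos posI posR t ∨
      E.stepPos posI posR u = E.stepPos posI posR t ∧ u < t) :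
    E.sortKey posI posR u < E.sortKey posI posR t := by
  rw [sortKey, sortKey, if_neg hu, if_neg ht, Prod.Lex.toLex_lt_toLex, Prod.Lex.toLex_lt_toLex]
  have hle := snapFrom_mono hL (show E.stepPos posI posR u ≤ E.stepPos posI posR t by omega)
  rcases hle.lt_or_eq with h1 | h1
  · exact Or.inl h1
  · exact Or.inr ⟨h1, h⟩

/-- Sorting by the key preserves the order of the steps of each process. -/
lemma sortKey_lt_of_actor_eq (hE : E.Live) (hL : Layout y O.inv O.resp posI posR)
    (hv : ∀ p q, posI q < posR p ↔ O.tag q ∈ O.view p) {u t : ℕ}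
    (hact : E.actor u = E.actor t) (hut : u < t) :
    E.sortKey posI posR u < E.sortKey posI posR t := by
  by_cases hu : E.IsOrdinary u <;> by_cases ht : E.IsOrdinary t
  · rw [sortKey, sortKey, if_pos hu, if_pos ht, Prod.Lex.toLex_lt_toLex]
    exact Or.inl hut
  · rw [sortKey, sortKey, if_pos hu, if_neg ht, Prod.Lex.toLex_lt_toLex]
    left
    obtain ⟨⟨i, k⟩, r, h2, h7, rfl, hi, hc⟩ := eq_time_of_not_isOrdinary hE ht
    rw [stepPos_time hE _ _ _ h2 h7]
    -- An ordinary step before a step for operation `k` takes place before its invocation is sent,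
    -- and the write of the invocation precedes every snapshot that contains it.
    have hle : u ≤ E.sendTime (i, k) := by
      rw [← not_lt, sendTime, ← lt_clock_iff hE (by omega)]
      have h1 := E.clock_mono i hut.le
      simp only at h1 hc ⊢
      rcases hu with hu | hu
      · rcases (E.step u).clock_cases with hs | hs
        · have h02 := hs.2
          rw [ProcState.phase_eq] at h02
          change E.clock _ u % 8 = 0 ∨ E.clock _ u % 8 = 2 at h02
          rw [hact, hi] at h02
          simp only at h02
          omega
        · have h3 : E.clock (E.actor u) (u + 1) = E.clock (E.actor u) u + 1 := hs.1
          rw [IsMemStep] at hu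
          omega
      · rw [hact, hi] at hu
        simp only at hu
        omega
    have h1 := sendTime_lt_writeTime hE (i, k)
    have h2 := writeTime_lt_snapFrom hE hL hv (i, k)
    have h3 := snapFrom_mono hL (hL.lt (i, k)).le
    simp only
    split_ifs <;> omega
  · rw [sortKey, sortKey, if_neg hu, if_pos ht, Prod.Lex.toLex_lt_toLex]
    left
    obtain ⟨⟨i, k⟩, r, h2, h7, rfl, hi, hc⟩ := eq_time_of_not_isOrdinary hE hu
    rw [stepPos_time hE _ _ _ h2 h7]
    -- An ordinary step after a step for operation `k` takes place after its response is received,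
    -- and the key moves the snapshot and the reception to the time of the snapshot or earlier.
    have h1 : E.recvTime (i, k) < t := by
      rw [recvTime, ← lt_clock_iff hE (by omega)]
      have h1 := (lt_clock_iff hE (by omega)).2 hut
      simp only at h1 ⊢
      rcases ht with ht | ht
      · rcases (E.step t).clock_cases with hs | hs
        · have h02 := hs.2
          rw [ProcState.phase_eq] at h02
          change E.clock _ t % 8 = 0 ∨ E.clock _ t % 8 = 2 at h02
          rw [← hact, hi] at h02
          simp only at h02
          omega
        · have h3 : E.clock (E.actor t) (t + 1) = E.clock (E.actor t) t + 1 := hs.1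
          rw [IsMemStep] at ht
          omega
      · rw [← hact, hi] at ht
        simp only at ht
        omega
    have h2 := snapTime_lt_recvTime hE (i, k)
    have h3 := snapFrom_le (E := E) posR (le_refl (posR (i, k)))
    have h4 := snapFrom_mono hL (hL.lt (i, k)).le
    simp only
    split_ifs <;> omega
  · refine sortKey_lt_of_stepPos_lt hL hu ht ?_
    obtain ⟨⟨i, k⟩, r, h2, h7, rfl, hi, hc⟩ := eq_time_of_not_isOrdinary hE hu
    obtain ⟨⟨j, l⟩, q, h2', h7', rfl, hj, hc'⟩ := eq_time_of_not_isOrdinary hE ht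
    have hij : i = j := hi.symm.trans (hact.trans hj)
    subst hij
    rw [stepPos_time hE _ _ _ h2 h7, stepPos_time hE _ _ _ h2' h7']
    have h1 := (lt_clock_iff hE (by omega)).2 hut
    simp only at h1 hc' hut ⊢
    rcases lt_trichotomy k l with h | h | h
    · left
      have h3 := hL.lt (i, k)
      have h4 := hL.lt (i, l)
      have h5 := (hL.posR_lt_posI_iff (i := i)).2 h
      split_ifs <;> omega
    · subst h
      have := hL.lt (i, k)
      split_ifs <;> omega
    · omega

lemma finite_sortKey_lt (hE : E.Live) (hL : Layout y O.inv O.resp posI posR) (t : ℕ) :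
    {u | E.sortKey posI posR u < E.sortKey posI posR t}.Finite := by
  generalize hT : (ofLex (E.sortKey posI posR t)).1 = T
  -- Finitely many snapshots occur up to time `T`, so `snapFrom` is at most `T` at finitely many
  -- positions only.
  have hfinR : {p | E.snapTime p ≤ T}.Finite :=
    (Set.finite_Iic T).preimage (snapTime_injective hE).injOn
  obtain ⟨B, hB⟩ := (hfinR.image posR).bddAbove
  have hfinI : {p | posI p ≤ B}.Finite := (Set.finite_Iic B).preimage hL.posI_inj.injOn
  refine ((Set.finite_Iic T).union ((hfinI.prod (Set.finite_Iic 7)).image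
    fun x : Op n × ℕ => E.time x.1.1 (8 * x.1.2 + x.2))).subset fun u hu => ?_
  have hle : (ofLex (E.sortKey posI posR u)).1 ≤ T := by
    rcases Prod.Lex.lt_iff.1 (Set.mem_ofPred_eq ▸ hu) with h | h
    · exact hT ▸ h.le
    · exact hT ▸ h.1.le
  by_cases ho : E.IsOrdinary u
  · rw [sortKey, if_pos ho] at hle
    exact Or.inl hle
  · rw [sortKey, if_neg ho] at hle
    obtain ⟨p, r, h2, h7, rfl, -, -⟩ := eq_time_of_not_isOrdinary hE ho
    refine Or.inr ⟨(p, r), ⟨?_, h7⟩, rfl⟩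
    obtain ⟨q, hq, hq'⟩ := snapFrom_mem hL (E.stepPos posI posR (E.time p.1 (8 * p.2 + r)))
    have hqT : E.snapTime q ≤ T := hq'.trans_le hle
    have h3 := hB ⟨q, hqT, rfl⟩
    rw [stepPos_time hE _ _ _ h2 h7] at hq
    have := hL.lt p
    change posI p ≤ B
    split_ifs at hq <;> omega

end

/-- Every sketch of an execution is the input of an indistinguishable execution: sort the steps by
`sortKey`. -/
theorem exists_indist_of_isSketch (hE : E.Live) (hF : E.Fair) {y : A.Word} (hy : E.IsSketch y) :
    ∃ E' : Execution V, E'.Fair ∧ E'.Indist E ∧ E'.IsInput y := by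
  obtain ⟨O⟩ := hE.nonempty_ops
  obtain ⟨posI, posR, hL, hv⟩ := O.layout_of_isSketch hE hy
  obtain ⟨σ, hσ⟩ := exists_equiv_of_key (sortKey_injective E posI posR) (finite_sortKey_lt hE hL)
  have hpos : ∀ (p q : Op n) (r s : ℕ), 2 ≤ r → r ≤ 7 → 2 ≤ s → s ≤ 7 →
      (if r ≤ 5 then posI p else posR p) < (if s ≤ 5 then posI q else posR q) →
      σ (E.time p.1 (8 * p.2 + r)) < σ (E.time q.1 (8 * q.2 + s)) := by
    intro p q r s h2 h7 h2' h7' h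
    refine hσ _ _ (sortKey_lt_of_stepPos_lt hL (not_isOrdinary_time hE p h2 h7)
      (not_isOrdinary_time hE q h2' h7') (Or.inl ?_))
    rwa [stepPos_time hE _ _ _ h2 h7, stepPos_time hE _ _ _ h2' h7']
  obtain ⟨E', hF', hI', hl⟩ := exists_permuted O hE hF σ
    (fun u t h h' => hσ _ _ (sortKey_lt_of_actor_eq hE hL hv h h'))
    (fun u t hu ht h => hσ _ _ (by
      rw [sortKey, sortKey, if_pos (show E.IsOrdinary u from Or.inl hu),
        if_pos (show E.IsOrdinary t from Or.inl ht), Prod.Lex.toLex_lt_toLex]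
      exact Or.inl h))
    (fun p q => by
      rw [← O.tag_mem_view hE, ← hv]
      constructor
      · intro h
        by_contra hle
        have hlt := lt_of_le_of_ne (not_lt.1 hle) (hL.posI_ne_posR q p).symm
        exact absurd (hpos p q 6 3 (by omega) (by omega) (by omega) (by omega) (by simpa using hlt))
          h.not_gt
      · exact fun h => hpos q p 3 6 (by omega) (by omega) (by omega) (by omega) (by simpa using h))
  refine ⟨E', hF', hI', ?_⟩
  have he : ∀ m, ∃ (p : Op n) (r : ℕ), (r = 2 ∨ r = 7) ∧ m = (if r ≤ 5 then posI p else posR p) ∧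
      (E.label (E.time p.1 (8 * p.2 + r))).sym = some (y m) := by
    intro m
    obtain ⟨p, rfl | rfl⟩ := hL.surj m
    · exact ⟨p, 2, Or.inl rfl, by simp, by rw [hL.inv_eq]; exact (O.steps hE p).1⟩
    · exact ⟨p, 7, Or.inr rfl, by simp, by rw [hL.resp_eq]; exact O.recv_sym hE p⟩
  choose p r hr hm hsym using he
  refine ⟨fun m => σ (E.time (p m).1 (8 * (p m).2 + r m)), fun l m hlm => ?_, ?_, fun m => ?_⟩
  · refine hpos _ _ _ _ ?_ ?_ ?_ ?_ ?_
    · have := hr l; omega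
    · have := hr l; omega
    · have := hr m; omega
    · have := hr m; omega
    · rwa [← hm, ← hm]
  · ext s
    simp only [Set.mem_range, Set.mem_ofPred_eq, hl]
    constructor
    · rintro ⟨m, rfl⟩
      rw [Equiv.symm_apply_apply, hsym]
      exact Option.some_ne_none _
    · intro hs
      obtain ⟨q, hq | hq⟩ := Ops.exists_of_sym_ne_none hE hs
      · refine ⟨posI q, ?_⟩
        rw [← Equiv.eq_symm_apply, hq, sendTime]
        have h := hm (posI q)
        rcases hr (posI q) with h' | h' <;> rw [h'] at h ⊢ <;> simp at h
        · rw [← hL.posI_inj h]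
        · exact absurd h (hL.posI_ne_posR _ _)
      · refine ⟨posR q, ?_⟩
        rw [← Equiv.eq_symm_apply, hq, recvTime]
        have h := hm (posR q)
        rcases hr (posR q) with h' | h' <;> rw [h'] at h ⊢ <;> simp at h
        · exact absurd h.symm (hL.posI_ne_posR _ _)
        · rw [← hL.posR_inj h]
  · rw [hl, Equiv.symm_apply_apply, hsym]

end Execution

/-! ### The counter in terms of operations -/

/-- What a process knows about one of its own operations: its invocation, its response and the
number of `inc`s in its view. -/
structure OpRecord where
  inv : CounterInv
  resp : CounterResp
  bound : ℕ

/-- The `k`-th operation of a process with the operations `h` satisfies the requirements of the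
counter that concern this process only. -/
structure LocallyCorrect (h : ℕ → OpRecord) (k : ℕ) : Prop where
  matching : ((h k).inv = .inc ∧ (h k).resp = .ack) ∨
    ((h k).inv = .read ∧ ∃ m, (h k).resp = .val m)
  ownIncs : ∀ m : ℕ, (h k).resp = .val m → {j | j < k ∧ (h j).inv = .inc}.encard ≤ (m : ℕ∞)
  monotone : ∀ k' m m', k' < k → (h k').resp = .val m' → (h k).resp = .val m →
    (∀ j, k' < j → j < k → (h j).inv ≠ .read) → m' ≤ m

/-- The `inc` operations. -/
def incs (r : Fin n → ℕ → OpRecord) : Set (Op n) := {p | (r p.1 p.2).inv = .inc}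

/-- The operations satisfy all requirements of the counter but the upper bound on the values that
are read. These requirements do not depend on the interleaving of the processes. -/
structure OrderFree (r : Fin n → ℕ → OpRecord) : Prop where
  local_correct : ∀ i k, LocallyCorrect (r i) k
  finite_incs : (incs r).Finite
  converges : {p : Op n | (r p.1 p.2).resp ≠ .val (incs r).ncard}.Finite

namespace Layout

variable {r : Fin n → ℕ → OpRecord} {y : (counterAlphabet n).Word} {posI posR : Op n → ℕ}

lemma precedes_or_concurrent_iff {A : DistAlphabet n} {y : A.Word} {inv : ∀ p : Op n, A.Inv p.1}
    {resp : ∀ p : Op n, A.Resp p.1} {posI posR : Op n → ℕ} (h : Layout y inv resp posI posR)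
    (p q : Op n) : (Precedes y q p ∨ Concurrent y q p) ↔ posI q < posR p := by
  simp only [Concurrent, Precedes, h.invPos_eq, h.respPos_eq]
  have h1 := h.lt p
  have h2 := h.lt q
  have h3 := h.posI_ne_posR q p
  omega

/-- Membership of a word in the language of the counter, in terms of its operations. -/
lemma mem_SEC_COUNT_iff
    (h : Layout (A := counterAlphabet n) y (fun p => (r p.1 p.2).inv) (fun p => (r p.1 p.2).resp)
      posI posR) :
    y ∈ SEC_COUNT n ↔ OrderFree r ∧ ∀ (p : Op n) (m : ℕ), (r p.1 p.2).resp = .val m →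
      (m : ℕ∞) ≤ {q | q ∈ incs r ∧ posI q < posR p}.encard := by
  have hinc : ∀ p, IsInc y p ↔ p ∈ incs r := fun p => by
    rw [IsInc, h.invPos_eq, h.inv_eq]
    simp [incs]
  have hread : ∀ p, IsRead y p ↔ (r p.1 p.2).inv = .read := fun p => by
    rw [IsRead, h.invPos_eq, h.inv_eq]
    simp
  have hresp : ∀ p w, y (respPos y p) = ⟨p.1, Sum.inr w⟩ ↔ (r p.1 p.2).resp = w := fun p w => by
    rw [h.respPos_eq, h.resp_eq]
    simp
  have hreads : ∀ p m, Reads y p m ↔ (r p.1 p.2).inv = .read ∧ (r p.1 p.2).resp = .val m :=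
    fun p m => by rw [Reads, hread, hresp]
  have hown : ∀ p : Op n, {q : Op n | q.1 = p.1 ∧ IsInc y q ∧ Precedes y q p}.encard =
      {j | j < p.2 ∧ (r p.1 j).inv = .inc}.encard := by
    intro p
    rw [← (Prod.mk_right_injective p.1).encard_image {j | j < p.2 ∧ (r p.1 j).inv = .inc}]
    refine congrArg Set.encard (Set.ext ?_)
    rintro ⟨i, j⟩
    simp only [Set.mem_ofPred_eq, hinc, incs, Set.mem_image, Prod.mk.injEq, Precedes,
      h.respPos_eq, h.invPos_eq]
    constructor
    · rintro ⟨rfl, hj, hlt⟩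
      exact ⟨j, ⟨h.posR_lt_posI_iff.1 hlt, hj⟩, rfl, rfl⟩
    · rintro ⟨j, ⟨hlt, hj⟩, rfl, rfl⟩
      exact ⟨rfl, hj, h.posR_lt_posI_iff.2 hlt⟩
  have hbounded : ∀ p : Op n, {q : Op n | IsInc y q ∧ (Precedes y q p ∨ Concurrent y q p)} =
      {q | q ∈ incs r ∧ posI q < posR p} := fun p => by
    simp only [hinc, h.precedes_or_concurrent_iff]
  have hprefix : ∀ N, OnlyReadsFrom y N →
      {q : Op n | IsInc y q ∧ respPos y q < N} = incs r := by
    intro N hN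
    ext q
    simp only [Set.mem_ofPred_eq, hinc, and_iff_left_iff_imp]
    intro hq
    by_contra hlt
    have h1 := (hread q).1 (hN q (not_lt.1 hlt))
    rw [incs, Set.mem_ofPred_eq, h1] at hq
    cases hq
  constructor
  · rintro ⟨-, hy⟩
    have hmatch : ∀ p : Op n, ((r p.1 p.2).inv = .inc ∧ (r p.1 p.2).resp = .ack) ∨
        ((r p.1 p.2).inv = .read ∧ ∃ m, (r p.1 p.2).resp = .val m) := fun p => by
      have := hy.matching p
      simpa only [hinc, incs, Set.mem_ofPred_eq, hresp, hreads, exists_and_left] using this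
    have hval : ∀ (p : Op n) m, (r p.1 p.2).resp = .val m → Reads y p m := fun p m hp => by
      rw [hreads]
      rcases hmatch p with h1 | h1
      · rw [hp] at h1
        cases h1.2
      · exact ⟨h1.1, hp⟩
    obtain ⟨N, hN⟩ := hy.finallyReads
    have hfin : (incs r).Finite := by
      refine ((Set.finite_Iio N).preimage h.posR_inj.injOn).subset fun q hq => ?_
      rw [← hprefix N hN] at hq
      rw [Set.mem_preimage, ← h.respPos_eq]
      exact hq.2
    refine ⟨⟨fun i k => ⟨hmatch (i, k), fun m hm => ?_, fun k' m m' hk hm' hm hj => ?_⟩, hfin, ?_⟩,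
      fun p m hm => hbounded p ▸ hy.bounded p m (hval p m hm)⟩
    · exact hown (i, k) ▸ hy.ownIncs (i, k) m (hval (i, k) m hm)
    · exact hy.monotone i k k' m m' hk (hval (i, k') m' hm') (hval (i, k) m hm)
        fun j h1 h2 => (hread (i, j)).not.2 (hj j h1 h2)
    · obtain ⟨c, hc, T, hT⟩ := hy.converges N hN
      rw [hprefix N hN, ← hfin.cast_ncard_eq, Nat.cast_inj] at hc
      refine ((Set.finite_Iio T).preimage h.posR_inj.injOn).subset fun p hp => ?_
      rw [Set.mem_preimage, Set.mem_Iio, ← not_le, ← h.respPos_eq]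
      intro hle
      exact hp (hc ▸ ((hreads p c).1 (hT p hle)).2)
  · rintro ⟨hr, hb⟩
    have hval : ∀ {p m}, Reads y p m → (r p.1 p.2).resp = .val m := fun hp => ((hreads _ _).1 hp).2
    have hmatch := fun p : Op n => (hr.local_correct p.1 p.2).matching
    obtain ⟨T, hT⟩ := ((hr.finite_incs.union hr.converges).image posR).bddAbove
    have hlate : ∀ p : Op n, T + 1 ≤ posR p → Reads y p (incs r).ncard := by
      intro p hp
      have hp' : p ∉ incs r ∪ {p : Op n | (r p.1 p.2).resp ≠ .val (incs r).ncard} := fun hmem =>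
        absurd (hT ⟨p, hmem, rfl⟩) (by omega)
      rw [Set.mem_union, not_or, Set.mem_ofPred_eq, not_not] at hp'
      rw [hreads]
      exact ⟨((hmatch p).resolve_left fun h1 => hp'.1 h1.1).1, hp'.2⟩
    refine ⟨h.wellFormed, ⟨fun p => ?_, fun p m hp => ?_, fun i k k' m m' hk hm' hm hj => ?_,
      ⟨T + 1, fun p hp => (hlate p (h.respPos_eq p ▸ hp)).1⟩, fun N hN => ?_⟩, fun p m hp => ?_⟩
    · simpa only [hinc, incs, Set.mem_ofPred_eq, hresp, hreads, exists_and_left] using hmatch p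
    · rw [hown]
      exact (hr.local_correct p.1 p.2).ownIncs m (hval hp)
    · exact (hr.local_correct i k).monotone k' m m' hk (hval hm') (hval hm)
        fun j h1 h2 => (hread (i, j)).not.1 (hj j h1 h2)
    · refine ⟨(incs r).ncard, ?_, T + 1, fun p hp => hlate p (h.respPos_eq p ▸ hp)⟩
      rw [hprefix N hN, hr.finite_incs.cast_ncard_eq]
    · rw [hbounded]
      exact hb p m (hval hp)

end Layout

/-! ### The monitor -/

/-- A process objects to its `k`-th operation if it already knows that the counter is violated, or
if the operation is one of those of which a correct run has only finitely many: an `inc`, or a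
`read` whose value differs from the number of `inc`s in its view. -/
def Suspicious (h : ℕ → OpRecord) (k : ℕ) : Prop :=
  (∃ j ≤ k, ¬ (LocallyCorrect h j ∧ ∀ m, (h j).resp = .val m → m ≤ (h j).bound)) ∨
    (h k).inv = .inc ∨ (h k).resp ≠ .val (h k).bound

lemma LocallyCorrect.congr {h h' : ℕ → OpRecord} {k : ℕ} (hh : ∀ j ≤ k, h j = h' j)
    (hk : LocallyCorrect h k) : LocallyCorrect h' k := by
  obtain ⟨h1, h2, h3⟩ := hk
  rw [hh k le_rfl] at h1 h2 h3
  refine ⟨h1, fun m hm => ?_, fun k' m m' hk' hm' hm hj => ?_⟩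
  · refine le_of_eq_of_le (congrArg Set.encard (Set.ext fun j => ?_)) (h2 m hm)
    exact and_congr_right fun hj => by rw [hh j hj.le]
  · refine h3 k' m m' hk' (by rwa [hh k' hk'.le]) hm fun j hj1 hj2 => ?_
    rw [hh j hj2.le]
    exact hj j hj1 hj2

lemma Suspicious.congr {h h' : ℕ → OpRecord} {k : ℕ} (hh : ∀ j ≤ k, h j = h' j)
    (hk : Suspicious h k) : Suspicious h' k := by
  rcases hk with ⟨j, hj, hn⟩ | hk
  · refine Or.inl ⟨j, hj, fun hc => hn ⟨hc.1.congr fun l hl => (hh l (hl.trans hj)).symm, ?_⟩⟩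
    rw [hh j hj]
    exact hc.2
  · rw [hh k le_rfl] at hk
    exact Or.inr hk

/-- The local state of a process of the monitor: the current invocation, the operations completed
so far, whether the atomic step after the current operation is still to be done, the value of the
shared memory after the last such step, and the next report. -/
structure MonitorState where
  cur : CounterInv
  count : ℕ
  hist : ℕ → OpRecord
  pending : Bool
  seen : ℕ
  verdict : Verdict

open Classical in
/-- The atomic step after an operation, on the number `m` of objections in the shared memory. -/
noncomputable def MonitorState.postStep (l : MonitorState) (m : ℕ) : ℕ × MonitorState :=
  let m' := if Suspicious l.hist (l.count - 1) then m + 1 else m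
  (m', { l with
    pending := false
    seen := m'
    verdict := if m' = l.seen then .yes else .no })

/-- The record of an operation. -/
noncomputable def opRecord (v : CounterInv) (w : CounterResp)
    (view : Set (TInv (counterAlphabet n))) : OpRecord :=
  ⟨v, w, {a : TInv (counterAlphabet n) | a ∈ view ∧ a.2.2 = CounterInv.inc}.ncard⟩

/-- The shared memory counts the objections of all processes. After each operation a process adds
its objection, if it has one, and reports `NO` if the number of objections has changed since its
previous operation. -/
noncomputable def monitor (n : ℕ) : Algorithm (counterAlphabet n) where
  Mem := ℕ
  Loc := fun _ => MonitorState
  memInit := 0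
  locInit := fun _ => ⟨.read, 0, fun _ => ⟨.read, .ack, 0⟩, false, 0, .yes⟩
  pick := fun _ l v => { l with cur := v }
  pre := fun _ _ => none
  receive := fun _ l w view =>
    { l with
      count := l.count + 1
      hist := Function.update l.hist l.count (opRecord l.cur w view)
      pending := true }
  post := fun _ l => if l.pending then some l.postStep else none
  report := fun _ l => l.verdict
  next := fun _ l => l

lemma monitor_post_eq_some {i : Fin n} {l : MonitorState} {f : ℕ → ℕ × MonitorState}
    (h : (monitor n).post i l = some f) : l.pending = true ∧ l.postStep = f := by
  change (if l.pending = true then some l.postStep else none) = some f at h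
  split_ifs at h with hp
  exact ⟨hp, Option.some.inj h⟩

lemma monitor_post_eq_none {i : Fin n} {l : MonitorState} (h : (monitor n).post i l = none) :
    l.pending = false := by
  change (if l.pending = true then some l.postStep else none) = none at h
  split_ifs at h with hp
  exact Bool.not_eq_true _ ▸ hp

/-! ### Runs of the monitor -/

/-- The progress of a process of the monitor: it advances by one with every step. An iteration,
counted from the reception of a response, consists of nine steps, the first of which is the atomic
step on the shared memory and the second is the report. -/
def fineClock {i : Fin n} (s : ProcState (monitor n) i) : ℕ :=
  9 * s.ops + match s.ctrl with
    | .atPost => if s.loc.pending then 0 else 1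
    | c => c.phase + 1

lemma LocalStep.fineClock {i : Fin n} {s s' : ProcState (monitor n) i} {m m' : ℕ}
    {a a' : Fin n → Set (TInv (counterAlphabet n))} {l : Label (counterAlphabet n) i}
    (h : LocalStep (monitor n) i s m a l s' m' a') : fineClock s' = fineClock s + 1 := by
  cases h with
  | pre l k u _ _ v f h => simp [monitor] at h
  | receive => simp [DRV.fineClock, Control.phase, monitor]; ring
  | post l k u _ _ f h =>
    obtain ⟨hp, rfl⟩ := monitor_post_eq_some h
    have hp' : (MonitorState.postStep l m).2.pending = false := rfl
    simp [DRV.fineClock, hp, hp']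
  | report l k u _ _ h =>
    have hp := monitor_post_eq_none h
    simp [DRV.fineClock, hp, Control.phase]
  | _ => simp [DRV.fineClock, Control.phase]

lemma LocalStep.exists_report {i : Fin n} {s s' : ProcState (monitor n) i} {m m' : ℕ}
    {a a' : Fin n → Set (TInv (counterAlphabet n))} {l : Label (counterAlphabet n) i}
    (h : LocalStep (monitor n) i s m a l s' m' a') (hc : DRV.fineClock s % 9 = 1) :
    l = .report s.loc.verdict := by
  cases h with
  | pre l k u _ _ v f h => simp [monitor] at h
  | post l k u _ _ f h =>
    simp [DRV.fineClock, (monitor_post_eq_some h).1] at hc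
  | report => rfl
  | _ => simp [DRV.fineClock, Control.phase] at hc

lemma LocalStep.fineClock_of_report {i : Fin n} {s s' : ProcState (monitor n) i} {m m' : ℕ}
    {a a' : Fin n → Set (TInv (counterAlphabet n))} {d : Verdict}
    (h : LocalStep (monitor n) i s m a (.report d) s' m' a') : DRV.fineClock s % 9 = 1 := by
  cases h with
  | report l k u _ _ h =>
    have hp := monitor_post_eq_none h
    simp [DRV.fineClock, hp]

/-- The atomic step after an operation. -/
lemma LocalStep.post_monitor {i : Fin n} {s s' : ProcState (monitor n) i} {m m' : ℕ}
    {a a' : Fin n → Set (TInv (counterAlphabet n))} {l : Label (counterAlphabet n) i}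
    (h : LocalStep (monitor n) i s m a l s' m' a') (hc : DRV.fineClock s % 9 = 0) :
    (Suspicious s.loc.hist (s.loc.count - 1) → m' = m + 1) ∧
      (¬ Suspicious s.loc.hist (s.loc.count - 1) → m' = m) ∧ s'.loc.seen = m' ∧
      (s'.loc.verdict = .no ↔ m' ≠ s.loc.seen) := by
  cases h with
  | pre l k u _ _ v f h => simp [monitor] at h
  | post l k u _ _ f h =>
    obtain ⟨hp, rfl⟩ := monitor_post_eq_some h
    refine ⟨fun h => if_pos h, fun h => if_neg h, rfl, ?_⟩
    simp only [MonitorState.postStep]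
    split_ifs <;> simp_all
  | report l k u _ _ h =>
    have hp := monitor_post_eq_none h
    simp [DRV.fineClock, hp] at hc
  | _ => simp [DRV.fineClock, Control.phase] at hc

lemma LocalStep.monitor_of_ne {i : Fin n} {s s' : ProcState (monitor n) i} {m m' : ℕ}
    {a a' : Fin n → Set (TInv (counterAlphabet n))} {l : Label (counterAlphabet n) i}
    (h : LocalStep (monitor n) i s m a l s' m' a') (hc : DRV.fineClock s % 9 ≠ 0) :
    m' = m ∧ s'.loc.seen = s.loc.seen := by
  cases h with
  | pre l k u _ _ v f h => simp [monitor] at h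
  | post l k u _ _ f h =>
    simp [DRV.fineClock, (monitor_post_eq_some h).1] at hc
  | _ => exact ⟨rfl, rfl⟩

namespace Execution

variable {E : Execution (monitor n)}

lemma fineClock_eq (i : Fin n) (t : ℕ) :
    fineClock ((E.cfg t).proc i) = Nat.count (fun t => E.actor t = i) t + 2 := by
  induction t with
  | zero => simp [E.start, Config.initial, fineClock, Control.phase]
  | succ t ih =>
    rw [Nat.count_succ]
    split_ifs with h
    · obtain ⟨l, -, -, hs⟩ := step_of_actor h
      rw [hs.fineClock, ih]
    · rw [E.idle t i (Ne.symm h), ih, add_zero]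

/-- The time of the step number `m` of process `i`. -/
noncomputable def nthStep (E : Execution (monitor n)) (i : Fin n) (m : ℕ) : ℕ :=
  Nat.nth (fun t => E.actor t = i) m

lemma actor_nthStep {i : Fin n} (hi : {t | E.actor t = i}.Infinite) (m : ℕ) :
    E.actor (E.nthStep i m) = i :=
  Nat.nth_mem_of_infinite hi m

lemma fineClock_nthStep {i : Fin n} (hi : {t | E.actor t = i}.Infinite) (m : ℕ) :
    fineClock ((E.cfg (E.nthStep i m)).proc i) = m + 2 := by
  rw [fineClock_eq, nthStep, Nat.count_nth_of_infinite hi]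

lemma nthStep_strictMono {i : Fin n} (hi : {t | E.actor t = i}.Infinite) :
    StrictMono (E.nthStep i) :=
  Nat.nth_strictMono hi

lemma eq_nthStep {i : Fin n} {t m : ℕ} (ht : E.actor t = i)
    (hm : fineClock ((E.cfg t).proc i) = m + 2) : t = E.nthStep i m := by
  rw [fineClock_eq] at hm
  rw [nthStep, ← Nat.add_right_cancel hm]
  exact (Nat.nth_count (p := fun t => E.actor t = i) ht).symm

lemma proc_nthStep_succ {i : Fin n} (hi : {t | E.actor t = i}.Infinite) (m : ℕ) :
    (E.cfg (E.nthStep i (m + 1))).proc i = (E.cfg (E.nthStep i m + 1)).proc i := by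
  refine proc_eq_of_idle (nthStep_strictMono hi (Nat.lt_succ_self m)) fun u hu hu' ha => ?_
  rw [← Nat.nth_count (p := fun t => E.actor t = i) ha] at hu hu'
  have h1 := (nthStep_strictMono hi).lt_iff_lt.1 (Nat.lt_of_succ_le hu)
  have h2 := (nthStep_strictMono hi).lt_iff_lt.1 hu'
  omega

end Execution

lemma waitFree_monitor (n : ℕ) : (monitor n).WaitFree := by
  intro E i hi
  refine (Set.infinite_range_of_injective (f := fun k => E.nthStep i (9 * k + 8)) ?_).mono ?_
  · intro k l h
    have := (Execution.nthStep_strictMono hi).injective h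
    omega
  · rintro _ ⟨k, rfl⟩
    have ha := Execution.actor_nthStep hi (9 * k + 8)
    obtain ⟨l, -, hl, hs⟩ := Execution.step_of_actor ha
    refine ⟨ha, _, ha, (hl _).1 (hs.exists_report ?_)⟩
    rw [Execution.fineClock_nthStep hi]
    omega

/-- The invocation of the operation that a process is executing. -/
def Control.curInv {A : DistAlphabet n} {i : Fin n} : Control A i → Option (A.Inv i)
  | .atPick => none
  | .atPre v => some v
  | .atWrite v => some v
  | .atForward v => some v
  | .atWait v => some v
  | .atSnapshot v _ => some v
  | .atReturn v _ _ => some v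
  | .atPost => none

lemma LocalStep.cur_eq {i : Fin n} {s s' : ProcState (monitor n) i} {m m' : ℕ}
    {a a' : Fin n → Set (TInv (counterAlphabet n))} {l : Label (counterAlphabet n) i}
    (h : LocalStep (monitor n) i s m a l s' m' a')
    (hs : ∀ v, s.ctrl.curInv = some v → s.loc.cur = v) :
    ∀ v, s'.ctrl.curInv = some v → s'.loc.cur = v := by
  cases h with
  | pre l k u _ _ v f h => simp [monitor] at h
  | pick => simp [Control.curInv, monitor]
  | _ => first | exact hs | simp [Control.curInv]

lemma LocalStep.hist_cases {i : Fin n} {s s' : ProcState (monitor n) i} {m m' : ℕ}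
    {a a' : Fin n → Set (TInv (counterAlphabet n))} {l : Label (counterAlphabet n) i}
    (h : LocalStep (monitor n) i s m a l s' m' a') :
    (s'.ops = s.ops ∧ s'.loc.count = s.loc.count ∧ s'.loc.hist = s.loc.hist) ∨
      ∃ v w u, s.ctrl = .atReturn v w u ∧ s'.ops = s.ops + 1 ∧ s'.loc.count = s.loc.count + 1 ∧
        s'.loc.hist = Function.update s.loc.hist s.loc.count (opRecord s.loc.cur w u) := by
  cases h with
  | pre l k u _ _ v f h => simp [monitor] at h
  | receive l k u _ _ v w view => exact Or.inr ⟨_, _, _, rfl, rfl, rfl, rfl⟩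
  | post l k u _ _ f h =>
    obtain ⟨hp, rfl⟩ := monitor_post_eq_some h
    exact Or.inl ⟨rfl, rfl, rfl⟩
  | _ => exact Or.inl ⟨rfl, rfl, rfl⟩

namespace Execution

variable {E : Execution (monitor n)}

/-- The records of the operations of process `i`. -/
noncomputable def Ops.record (O : E.Ops) (i : Fin n) (k : ℕ) : OpRecord :=
  opRecord (O.inv (i, k)) (O.resp (i, k)) (O.view (i, k))

lemma cur_eq (t : ℕ) (i : Fin n) :
    ∀ v, ((E.cfg t).proc i).ctrl.curInv = some v → ((E.cfg t).proc i).loc.cur = v := by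
  induction t with
  | zero => simp [E.start, Config.initial, Control.curInv]
  | succ t ih =>
    by_cases h : E.actor t = i
    · obtain ⟨l, -, -, hs⟩ := step_of_actor h
      exact hs.cur_eq ih
    · rwa [E.idle t i (Ne.symm h)]

/-- The history of a process consists of the records of its completed operations. -/
lemma hist_eq (hE : E.Live) (O : E.Ops) (t : ℕ) (i : Fin n) :
    ((E.cfg t).proc i).loc.count = ((E.cfg t).proc i).ops ∧
      ∀ k < ((E.cfg t).proc i).ops, ((E.cfg t).proc i).loc.hist k = O.record i k := by
  induction t with
  | zero => simp [E.start, Config.initial, monitor]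
  | succ t ih =>
    by_cases h : E.actor t = i
    · obtain ⟨l, -, -, hs⟩ := step_of_actor h
      rcases hs.hist_cases with ⟨h1, h2, h3⟩ | ⟨v, w, u, hc, h1, h2, h3⟩
      · rw [h1, h2, h3]
        exact ih
      · rw [h1, h2, h3, ih.1]
        refine ⟨rfl, fun k hk => ?_⟩
        rcases Nat.lt_succ_iff_lt_or_eq.1 hk with hk | rfl
        · rw [Function.update_of_ne hk.ne]
          exact ih.2 k hk
        · obtain ⟨hv, hw, hu⟩ := O.eq_of_hasOp hE ⟨t, h, rfl, hc⟩
          rw [Function.update_self, cur_eq t i v (by rw [hc]; rfl), hv, hw, hu]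
          rfl
    · rwa [E.idle t i (Ne.symm h)]

/-- The operations to which a process objects. -/
def Ops.suspects (O : E.Ops) : Set (Op n) := {p | Suspicious (O.record p.1) p.2}

lemma postStep_injective (hF : E.Fair) :
    Function.Injective fun p : Op n => E.nthStep p.1 (9 * p.2 + 7) := by
  rintro ⟨i, k⟩ ⟨j, l⟩ h
  simp only at h
  have hij : i = j := by
    rw [← actor_nthStep (hF i) (9 * k + 7), h, actor_nthStep (hF j)]
  subst hij
  have := (nthStep_strictMono (hF i)).injective h
  rw [show k = l by omega]

/-- The atomic step after the operation `p`. -/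
lemma post_step (hF : E.Fair) (hE : E.Live) (O : E.Ops) (i : Fin n) (k : ℕ) :
    let u := E.nthStep i (9 * k + 7)
    ((i, k) ∈ O.suspects → (E.cfg (u + 1)).mem = Nat.succ (E.cfg u).mem) ∧
      ((i, k) ∉ O.suspects → (E.cfg (u + 1)).mem = (E.cfg u).mem) ∧
      ((E.cfg (u + 1)).proc i).loc.seen = (E.cfg (u + 1)).mem ∧
      (((E.cfg (u + 1)).proc i).loc.verdict = .no ↔
        (E.cfg (u + 1)).mem ≠ ((E.cfg u).proc i).loc.seen) := by
  intro u
  have hc : fineClock ((E.cfg u).proc i) = 9 * (k + 1) := by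
    rw [fineClock_nthStep (hF i)]
    ring
  obtain ⟨l, -, -, hs⟩ := step_of_actor (actor_nthStep (hF i) (9 * k + 7))
  have hp := hs.post_monitor (by rw [show E.nthStep i (9 * k + 7) = u from rfl, hc]; omega)
  have hops : ((E.cfg u).proc i).ops = k + 1 := by
    have h8 := ((E.cfg u).proc i).ctrl.phase_lt
    rw [fineClock] at hc
    split at hc
    · split_ifs at hc <;> omega
    · omega
  have hh := hist_eq hE O u i
  rw [hops] at hh
  have hsus : Suspicious ((E.cfg u).proc i).loc.hist (((E.cfg u).proc i).loc.count - 1) ↔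
      (i, k) ∈ O.suspects := by
    rw [hh.1, Nat.add_sub_cancel]
    exact ⟨Suspicious.congr fun j hj => hh.2 j (by omega),
      Suspicious.congr fun j hj => (hh.2 j (by omega)).symm⟩
  change (Suspicious ((E.cfg u).proc i).loc.hist (((E.cfg u).proc i).loc.count - 1) → _) ∧
    (¬ Suspicious ((E.cfg u).proc i).loc.hist (((E.cfg u).proc i).loc.count - 1) → _) ∧ _ ∧ _ at hp
  rw [hsus] at hp
  exact hp

/-- The number of objections in the shared memory. -/
def objections (E : Execution (monitor n)) (t : ℕ) : ℕ := (E.cfg t).mem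

/-- The time of the atomic step after the operation `p`. -/
noncomputable def postTime (E : Execution (monitor n)) (p : Op n) : ℕ :=
  E.nthStep p.1 (9 * p.2 + 7)

lemma objections_cases (hF : E.Fair) (hE : E.Live) (O : E.Ops) (t : ℕ) :
    (E.objections (t + 1) = E.objections t ∧ t ∉ E.postTime '' O.suspects) ∨
      (E.objections (t + 1) = E.objections t + 1 ∧ t ∈ E.postTime '' O.suspects) := by
  have hc := E.fineClock_eq (E.actor t) t
  by_cases h0 : fineClock ((E.cfg t).proc (E.actor t)) % 9 = 0
  · obtain ⟨k, hk⟩ : ∃ k, fineClock ((E.cfg t).proc (E.actor t)) = 9 * k + 7 + 2 :=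
      ⟨fineClock ((E.cfg t).proc (E.actor t)) / 9 - 1, by omega⟩
    have ht : t = E.postTime (E.actor t, k) := eq_nthStep rfl hk
    have hp := post_step hF hE O (E.actor t) k
    change (_ → E.objections (E.postTime (E.actor t, k) + 1) =
      E.objections (E.postTime (E.actor t, k)) + 1) ∧
      (_ → E.objections (E.postTime (E.actor t, k) + 1) =
        E.objections (E.postTime (E.actor t, k))) ∧ _ at hp
    rw [← ht] at hp
    by_cases hs : (E.actor t, k) ∈ O.suspects
    · exact Or.inr ⟨hp.1 hs, _, hs, ht.symm⟩
    · refine Or.inl ⟨hp.2.1 hs, ?_⟩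
      rintro ⟨p, hps, hpt⟩
      exact hs (postStep_injective hF (hpt.trans ht) ▸ hps)
  · obtain ⟨l, -, -, hs⟩ := step_of_actor (E := E) (t := t) rfl
    refine Or.inl ⟨(hs.monitor_of_ne h0).1, ?_⟩
    rintro ⟨p, -, rfl⟩
    refine h0 ?_
    rw [postTime, actor_nthStep (hF p.1), fineClock_nthStep (hF p.1)]
    omega

lemma objections_mono (hF : E.Fair) (hE : E.Live) : Monotone E.objections := by
  obtain ⟨O⟩ := hE.nonempty_ops
  exact monotone_nat_of_le_succ fun t => by
    rcases objections_cases hF hE O t with h | h <;> omega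

lemma increments_eq (hF : E.Fair) (hE : E.Live) (O : E.Ops) :
    {t | E.objections t < E.objections (t + 1)} = E.postTime '' O.suspects := by
  ext t
  rw [Set.mem_ofPred_eq]
  rcases objections_cases hF hE O t with h | h
  · simp only [h, lt_irrefl]
  · simp only [h, lt_add_iff_pos_right, zero_lt_one]

lemma exists_eq_of_mem_reportTimes {i : Fin n} {t : ℕ} {d : Verdict} (h : t ∈ E.reportTimes i d) :
    ∃ k, t = E.nthStep i (9 * k + 8) := by
  obtain ⟨hi, hd⟩ := h
  obtain ⟨l, -, hl, hs⟩ := step_of_actor hi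
  rw [(hl d).2 hd] at hs
  have h1 := hs.fineClock_of_report
  have h2 := E.fineClock_eq i t
  refine ⟨fineClock ((E.cfg t).proc i) / 9 - 1, eq_nthStep hi ?_⟩
  omega

/-- A process reports `NO` if and only if the number of objections has changed. -/
lemma mem_reportTimes_no_iff (hF : E.Fair) (hE : E.Live) (i : Fin n) (k : ℕ) :
    E.nthStep i (9 * (k + 1) + 8) ∈ E.reportTimes i .no ↔
      E.objections (E.postTime (i, k + 1) + 1) ≠ E.objections (E.postTime (i, k) + 1) := by
  obtain ⟨O⟩ := hE.nonempty_ops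
  -- Between two atomic steps, a process does not change the number it remembers.
  have hseen : ∀ j ≤ 8, ((E.cfg (E.nthStep i (9 * k + 8 + j))).proc i).loc.seen =
      E.objections (E.postTime (i, k) + 1) := by
    intro j hj
    induction j with
    | zero =>
      rw [add_zero, proc_nthStep_succ (hF i)]
      exact (post_step hF hE O i k).2.2.1
    | succ j ih =>
      rw [← ih (by omega), ← add_assoc, proc_nthStep_succ (hF i)]
      obtain ⟨l, -, -, hs⟩ := step_of_actor (actor_nthStep (hF i) (9 * k + 8 + j))
      refine (hs.monitor_of_ne ?_).2
      rw [fineClock_nthStep (hF i)]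
      omega
  have hv := (post_step hF hE O i (k + 1)).2.2.2
  rw [← proc_nthStep_succ (hF i), show 9 * (k + 1) + 7 = 9 * k + 8 + 8 by ring,
    hseen 8 le_rfl] at hv
  rw [postTime, show 9 * (k + 1) + 7 = 9 * k + 8 + 8 by ring]
  refine Iff.trans ?_ hv
  have ha := actor_nthStep (hF i) (9 * (k + 1) + 8)
  obtain ⟨l, -, hl, hs⟩ := step_of_actor ha
  have hr := hs.exists_report (by rw [fineClock_nthStep (hF i)]; omega)
  change (_ ∧ _) ↔ _
  rw [and_iff_right ha, ← hl, hr, show 9 * k + 8 + 8 + 1 = 9 * (k + 1) + 8 by ring]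
  exact ⟨fun h => by injection h, fun h => by rw [h]⟩

/-- Every process reports `NO` infinitely often if there are infinitely many objections, and no
process does otherwise. -/
theorem no_eq_top_iff (hF : E.Fair) (hE : E.Live) (O : E.Ops) (i : Fin n) :
    E.no i = ⊤ ↔ O.suspects.Infinite := by
  have hmono := objections_mono hF hE
  have hle : ∀ k, k ≤ E.postTime (i, k) := fun k =>
    le_trans (by omega) (nthStep_strictMono (hF i)).le_apply
  have hstep : Function.Injective fun k => E.nthStep i (9 * (k + 1) + 8) := fun k l h => by
    have := (nthStep_strictMono (hF i)).injective h
    omega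
  rw [no, Set.encard_eq_top_iff]
  constructor
  · -- Once the number of objections is constant, nobody sees it change.
    refine fun hinf hfin => hinf ?_
    have hH : {t | E.objections t < E.objections (t + 1)}.Finite := by
      rw [increments_eq hF hE O]
      exact Set.Finite.image _ hfin
    obtain ⟨N, hN⟩ := hH.bddAbove
    have hconst : ∀ t, N + 1 ≤ t → E.objections t = E.objections (N + 1) := by
      intro t ht
      induction t, ht using Nat.le_induction with
      | base => rfl
      | succ t ht ih =>
        rw [← ih]
        refine le_antisymm (not_lt.1 fun h => ?_) (hmono (Nat.le_succ t))
        have := hN h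
        omega
    refine ((Set.finite_Iic (N + 1)).image fun k => E.nthStep i (9 * k + 8)).subset fun t ht => ?_
    obtain ⟨k, rfl⟩ := exists_eq_of_mem_reportTimes ht
    refine ⟨k, ?_, rfl⟩
    by_contra hk
    rw [Set.mem_Iic, not_le] at hk
    obtain ⟨k, rfl⟩ : ∃ j, k = j + 1 := ⟨k - 1, by omega⟩
    have h1 := hle k
    have h2 := hle (k + 1)
    refine (mem_reportTimes_no_iff hF hE i k).1 ht ?_
    exact (hconst (E.postTime (i, k + 1) + 1) (by omega)).trans
      (hconst (E.postTime (i, k) + 1) (by omega)).symm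
  · -- If process `i` stops reporting `NO`, the number of objections that it sees is constant, but
    -- this number is unbounded.
    refine fun hinf hfin => ?_
    have hH : {t | E.objections t < E.objections (t + 1)}.Infinite := by
      rw [increments_eq hF hE O]
      exact hinf.image (postStep_injective hF).injOn
    obtain ⟨K, hK⟩ := (hfin.preimage hstep.injOn).bddAbove
    have hconst : ∀ k, K + 1 ≤ k → E.objections (E.postTime (i, k) + 1) =
        E.objections (E.postTime (i, K + 1) + 1) := by
      intro k hk
      induction k, hk using Nat.le_induction with
      | base => rfl
      | succ k hk ih =>
        rw [← ih]
        by_contra hne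
        have := hK ((mem_reportTimes_no_iff hF hE i k).2 hne)
        omega
    obtain ⟨t, ht⟩ := exists_lt_of_infinite_increments hmono hH
      (E.objections (E.postTime (i, K + 1) + 1))
    rw [← hconst (max (K + 1) t) (le_max_left _ _)] at ht
    have h1 := hle (max (K + 1) t)
    have h2 := le_max_right (K + 1) t
    exact ht.not_ge (hmono (by omega))

/-- The `inc`s in the view of an operation. -/
lemma Ops.bound_eq (hE : E.Live) (O : E.Ops) (p : Op n) :
    {q | q ∈ incs O.record ∧ O.tag q ∈ O.view p}.Finite ∧
      (O.record p.1 p.2).bound = {q | q ∈ incs O.record ∧ O.tag q ∈ O.view p}.ncard := by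
  refine ⟨((O.finite_view hE p).preimage O.tag_injective.injOn).subset fun q hq => hq.2, ?_⟩
  rw [← Set.ncard_image_of_injective _ O.tag_injective]
  refine congrArg Set.ncard (Set.ext fun a => ?_)
  constructor
  · rintro ⟨ha, hinc⟩
    obtain ⟨q, rfl, -⟩ := (O.mem_view hE).1 ha
    exact ⟨q, ⟨hinc, ha⟩, rfl⟩
  · rintro ⟨q, ⟨hinc, ha⟩, rfl⟩
    exact ⟨ha, hinc⟩

/-- The objections are finitely many if and only if the operations satisfy the requirements of the
counter, where the upper bound on the values that are read is taken from the views. -/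
lemma Ops.finite_suspects_iff (hE : E.Live) (O : E.Ops) :
    O.suspects.Finite ↔ OrderFree O.record ∧ ∀ (p : Op n) (m : ℕ),
      (O.record p.1 p.2).resp = .val m →
        (m : ℕ∞) ≤ {q | q ∈ incs O.record ∧ O.tag q ∈ O.view p}.encard := by
  have hbound : ∀ (p : Op n) (m : ℕ), m ≤ (O.record p.1 p.2).bound ↔
      (m : ℕ∞) ≤ {q | q ∈ incs O.record ∧ O.tag q ∈ O.view p}.encard := fun p m => by
    rw [(O.bound_eq hE p).2, ← (O.bound_eq hE p).1.cast_ncard_eq, Nat.cast_le]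
  simp only [← hbound]
  -- If there are finitely many `inc`s, all but finitely many snapshots come after all their writes.
  have hviews : (incs O.record).Finite →
      {p : Op n | (O.record p.1 p.2).bound ≠ (incs O.record).ncard}.Finite := by
    intro hfin
    refine (hfin.biUnion fun q _ => (Set.finite_Iic (E.writeTime q)).preimage
      (snapTime_injective hE).injOn).subset fun p hp => ?_
    by_contra hn
    refine hp ?_
    rw [(O.bound_eq hE p).2]
    refine congrArg Set.ncard (Set.ext fun q => and_iff_left_of_imp fun hq => ?_)
    rw [O.tag_mem_view hE]
    by_contra hlt
    exact hn (Set.mem_biUnion hq (not_lt.1 hlt))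
  constructor
  · intro hfin
    have hgood : ∀ (i : Fin n) (k : ℕ), LocallyCorrect (O.record i) k ∧
        ∀ m, (O.record i k).resp = .val m → m ≤ (O.record i k).bound := by
      intro i k
      by_contra hn
      refine Set.not_infinite.2 hfin ((Set.infinite_range_of_injective
        (f := fun j => ((i, k + j) : Op n)) fun j l h => by simpa using h).mono ?_)
      rintro _ ⟨j, rfl⟩
      exact Or.inl ⟨k, Nat.le_add_right k j, hn⟩
    have hincs : (incs O.record).Finite := hfin.subset fun p hp => Or.inr (Or.inl hp)
    refine ⟨⟨fun i k => (hgood i k).1, hincs, ?_⟩, fun p => (hgood p.1 p.2).2⟩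
    refine (hfin.union (hviews hincs)).subset fun p hp => ?_
    by_cases hb : (O.record p.1 p.2).bound = (incs O.record).ncard
    · exact Or.inl (Or.inr (Or.inr (hb ▸ hp)))
    · exact Or.inr hb
  · rintro ⟨⟨hl, hfin, hconv⟩, hb⟩
    refine ((hfin.union hconv).union (hviews hfin)).subset fun p hp => ?_
    rcases hp with ⟨j, -, hj⟩ | hp | hp
    · exact absurd ⟨hl p.1 j, hb (p.1, j)⟩ hj
    · exact Or.inl (Or.inl hp)
    · by_cases hbp : (O.record p.1 p.2).bound = (incs O.record).ncard
      · exact Or.inl (Or.inr (hbp ▸ hp))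
      · exact Or.inr hbp

end Execution

/-- If there are finitely many objections, then the input belongs to the language; and if some
sketch belongs to the language, then there are finitely many objections. -/
theorem monitor_predictivelyWeaklyDecides (n : ℕ) [NeZero n] :
    (monitor n).PredictivelyWeaklyDecides (SEC_COUNT n) := by
  intro E hF
  have hE := hF.live (waitFree_monitor n)
  obtain ⟨O⟩ := hE.nonempty_ops
  obtain ⟨x, posI, posR, hx, hL, hv⟩ := O.exists_input hE
  refine ⟨x, hx, fun _ => ?_, fun hxn p => ?_⟩
  · by_cases hfin : O.suspects.Finite
    · refine Or.inl fun p => lt_top_iff_ne_top.2 fun h => ?_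
      exact (Execution.no_eq_top_iff hF hE O p).1 h hfin
    · refine Or.inr ⟨⟨0, (Execution.no_eq_top_iff hF hE O 0).2 hfin⟩, hE.exists_isSketch,
        fun y hy => ⟨fun hyL => hfin ?_, Execution.exists_indist_of_isSketch hE hF hy⟩⟩
      obtain ⟨posI', posR', hL', hv'⟩ := O.layout_of_isSketch hE hy
      rw [O.finite_suspects_iff hE]
      have := (Layout.mem_SEC_COUNT_iff (r := O.record) hL').1 hyL
      simpa only [hv'] using this
  · rw [Execution.no_eq_top_iff hF hE O]
    refine fun hfin => hxn ?_
    obtain ⟨h1, h2⟩ := (O.finite_suspects_iff hE).1 hfin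
    refine (Layout.mem_SEC_COUNT_iff (r := O.record) hL).2 ⟨h1, fun p m hm => (h2 p m hm).trans ?_⟩
    exact Set.encard_le_encard fun q hq => ⟨hq.1, hv p q hq.2⟩

end DRV

theorem mainTheorem8 (n : ℕ) (hn : 2 ≤ n) :
    DRV.SEC_COUNT n ∈ DRV.PWD (DRV.counterAlphabet n) := by
  have : NeZero n := ⟨by omega⟩
  exact ⟨fun x hx => hx.1, DRV.monitor n, DRV.waitFree_monitor n,
    DRV.monitor_predictivelyWeaklyDecides n⟩
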